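/- Let $s\ge 1$ be a natural number. There is a constant $c_s>0$, depending only on $s$, such that the following holds. Let $d\ge 1$ be a natural number, let $K\ge 1$ be real, let $A\subseteq\mathbb{Z}$ be a finite set with $|A|\ge 2$ and $|A\cdot A|=K|A|$, where $A\cdot A=\{ab : a,b\in A\}$, let $\varphi\in\mathbb{Z}[x]$ be a polynomial of degree $d$, and let $\mathfrak{a}:\mathbb{Z}\to[0,\infty)$ be a function. Write $e(\theta)=e^{2\pi i\theta}$ and $C=8+12\log_2(d^2+2)+6\log_2(2s)$. Then $$\int_{[0,1)}\Big|\sum_{a\in A}\mathfrak{a}(a)\,e(\alpha\varphi(a))\Big|^{2s}\,d\alpha\;\le\; c_s\,K^{Cs}\,(\log_2|A|)^{2s}\Big(\sum_{a\in A}\mathfrak{a}(a)^2\Big)^s .$$ -/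

import Mathlib

open scoped Pointwise

/-- The additive character `e(θ) = exp(2πiθ)` of the real line. -/
noncomputable def addChar (θ : ℝ) : ℂ := Complex.exp (2 * Real.pi * Complex.I * θ)

/-- The exponential sum `∑_{a ∈ A} w(a) e(α φ(a))`. -/
noncomputable def weightedExpSum (A : Finset ℤ) (w : ℤ → ℝ) (φ : Polynomial ℤ) (α : ℝ) : ℂ :=
  ∑ a ∈ A, (w a : ℂ) * addChar (α * ((φ.eval a : ℤ) : ℝ))

/-! Write ‖f‖ for the L^{2s} norm over a period; `sqNorm` is its square.

Analytic half. Fix a prime p and sort the nonzero integers by v_p(a). Outside at most d² exceptional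
values j, all φ(a) - φ(0) with v_p(a) = j have the same p-adic valuation, and larger v_p(a) gives a
strictly larger one. So a power q of p divides every frequency above level j and none on level j. If
f is the sum over the higher levels, shifting α by 1/q shows that the level-j sum is orthogonal to
|f|^{2s-2} f, and a type 2 inequality (`sqNorm_add_le_of_orthogonal`) makes squared norms additive
up to a constant. One p-adic query thus costs a factor (d² + 2)(2s)², and a set separated up to sign
by m adaptive queries satisfies a square function bound with constant exponential in m
(`sqNorm_expSum_le_of_adaptiveSplit`).

Combinatorial half. Say that A expands products by g if |XYA| ≥ g √(|X||Y|) for all finite X, Y. If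
two fibres of a valuation expand by g₁ and g₂, a Prékopa–Leindler inequality on ℤ
(`two_point_prekopa_leindler`) shows that the whole set expands by g₁ + g₂. Induction over fibres
yields A' ⊆ A of density at least 1/g and depth at most log₂ g (`exists_adaptiveSplit_subset`).
Taking X = Y = A, Plünnecke–Ruzsa forces g ≤ K³. Averaging over dilates of A' transfers the bound to
A at the cost of K⁵; the element 0 is treated separately. -/

open scoped Pointwise

open Finset MeasureTheory

/-! ### Prékopa–Leindler on ℤ with a two-point set. -/

/-- Counting form of the one-dimensional inequality, for a fixed level. -/
lemma sum_card_level_le {P Q R : ℕ → Finset ℤ} {N : ℕ} {j₁ j₂ : ℤ} (hN : 1 ≤ N) (hj : j₁ ≠ j₂)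
    (hP : Antitone P) (hP0 : (P 0).Nonempty) (hQ0 : (Q 0).Nonempty)
    (h₁ : ∀ u u' x y, x ∈ P u → y ∈ Q u' → x + y + j₁ ∈ R (u + u'))
    (h₂ : ∀ w u u' x y, u + u' = w + N → x ∈ P u → y ∈ Q u' →
      x + y + j₁ ∈ R w ∧ x + y + j₂ ∈ R w) :
    ∑ i ∈ range N, #(P i) + ∑ i ∈ range N, #(Q (i + 1)) ≤ ∑ i ∈ range N, #(R i) := by
  have hone : ∀ w u u', u + u' = w → (P u).Nonempty → (Q u').Nonempty →
      #(P u) + #(Q u') ≤ #(R w) + 1 := by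
    intro w u u' hw hp hq
    have h1 := cauchy_davenport_of_isAddTorsionFree hp hq
    have h2 : (P u + Q u').card ≤ #(R w) := by
      refine card_le_card_of_injOn (· + j₁) ?_ (add_left_injective j₁).injOn
      intro z hz
      obtain ⟨x, hx, y, hy, rfl⟩ := mem_add.1 hz
      exact hw ▸ h₁ u u' x y hx hy
    omega
  have htwo : ∀ w u u', u + u' = w + N → (P u).Nonempty → (Q u').Nonempty →
      #(P u) + #(Q u') ≤ #(R w) := by
    intro w u u' hw hp hq
    have h1 := cauchy_davenport_of_isAddTorsionFree hp hq
    have h3 := cauchy_davenport_of_isAddTorsionFree (hp.add hq) (insert_nonempty j₁ {j₂})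
    have h2 : ((P u + Q u') + {j₁, j₂}).card ≤ #(R w) := by
      refine card_le_card fun z hz => ?_
      obtain ⟨t, ht, j, hj, rfl⟩ := mem_add.1 hz
      obtain ⟨x, hx, y, hy, rfl⟩ := mem_add.1 ht
      have := h₂ w u u' x y hw hx hy
      rcases mem_insert.1 hj with rfl | hj
      · exact this.1
      · rw [mem_singleton.1 hj]; exact this.2
    rw [card_pair hj] at h3
    have := (hp.add hq).card_pos
    omega
  have hbase : ∀ i, #(P i) ≤ #(R i) := by
    intro i
    rcases (P i).eq_empty_or_nonempty with h | h
    · simp [h]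
    · have := hone i i 0 rfl h hQ0
      have := hQ0.card_pos
      omega
  -- δ is the first level at which `P` has shrunk, capped at N.
  obtain ⟨δ, hδ1, hδN, hδP, hδlt⟩ : ∃ δ, 1 ≤ δ ∧ δ ≤ N ∧ #(P (δ - 1)) = #(P 0) ∧
      ∀ i, δ ≤ i → i < N → #(P i) < #(P 0) := by
    by_cases hall : ∃ i < N, #(P i) < #(P 0)
    · classical
      refine ⟨Nat.find hall, ?_, ?_, ?_, ?_⟩
      · rw [Nat.one_le_iff_ne_zero]
        intro h
        have := (Nat.find_spec hall).2
        rw [h] at this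
        omega
      · exact (Nat.find_spec hall).1.le
      · have h0 : 1 ≤ Nat.find hall := by
          rw [Nat.one_le_iff_ne_zero]
          intro h
          have := (Nat.find_spec hall).2
          rw [h] at this
          omega
        have h1 := Nat.find_min hall (m := Nat.find hall - 1) (by omega)
        have h2 := (Nat.find_spec hall).1
        have h3 : #(P (Nat.find hall - 1)) ≤ #(P 0) := card_le_card (hP (Nat.zero_le _))
        push Not at h1
        have := h1 (by omega)
        omega
      · intro i hi _
        exact (card_le_card (hP hi)).trans_lt (Nat.find_spec hall).2
    · push Not at hall
      refine ⟨N, hN, le_rfl, le_antisymm (card_le_card (hP (Nat.zero_le _))) (hall _ (by omega)), ?_⟩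
      intro i h1 h2
      omega
  have hδne : (P (δ - 1)).Nonempty := card_pos.1 (hδP ▸ hP0.card_pos)
  have hPle : ∀ i, #(P i) ≤ #(P 0) := fun i => card_le_card (hP (Nat.zero_le _))
  -- Level δ - 1 of `P`, still of full size, serves for every i. For i < δ the second point cancels
  -- the -1 of Cauchy–Davenport; for i ≥ δ that -1 is affordable since `P i` is strictly smaller
  -- than `P 0`. The levels of `Q` used are N-δ+1, …, N and then 1, …, N-δ, so each of 1, …, N
  -- occurs once.
  have hkey : ∀ i ∈ range N,
      #(P i) + (if i < δ then #(Q (i + (N - δ) + 1)) else #(Q (i - δ + 1))) ≤ #(R i) := by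
    intro i hi
    have hi := mem_range.1 hi
    split_ifs with h
    · rcases (Q (i + (N - δ) + 1)).eq_empty_or_nonempty with hq | hq
      · simpa [hq] using hbase i
      · have := htwo i (δ - 1) (i + (N - δ) + 1) (by omega) hδne hq
        have := hPle i
        omega
    · rcases (Q (i - δ + 1)).eq_empty_or_nonempty with hq | hq
      · simpa [hq] using hbase i
      · have := hone i (δ - 1) (i - δ + 1) (by omega) hδne hq
        have := hδlt i (by omega) hi
        omega
  refine le_trans (le_of_eq ?_) (sum_le_sum hkey)
  rw [sum_add_distrib]
  congr 1
  obtain ⟨e, rfl⟩ : ∃ e, N = δ + e := ⟨N - δ, by omega⟩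
  have hA : ∑ i ∈ range (δ + e), (if i < δ then #(Q (i + (δ + e - δ) + 1)) else #(Q (i - δ + 1)))
      = ∑ i ∈ range δ, #(Q (e + i + 1)) + ∑ i ∈ range e, #(Q (i + 1)) := by
    rw [sum_range_add]
    congr 1
    · refine sum_congr rfl fun i hi => ?_
      rw [if_pos (mem_range.1 hi)]
      congr 3
      omega
    · refine sum_congr rfl fun i hi => ?_
      rw [if_neg (by omega)]
      congr 3
      omega
  rw [hA, add_comm δ e, sum_range_add, add_comm]

lemma setIntegral_Ioc_ite_le {c : ℝ} (hc : 0 ≤ c) :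
    ∫ τ in Set.Ioc (0 : ℝ) 1, (if τ ≤ c then (1 : ℝ) else 0) = min c 1 := by
  have h : (fun τ : ℝ => if τ ≤ c then (1 : ℝ) else 0) = (Set.Iic c).indicator 1 := by
    ext τ; simp [Set.indicator_apply]
  rw [h, MeasureTheory.integral_indicator_one measurableSet_Iic]
  rw [MeasureTheory.measureReal_restrict_apply measurableSet_Iic, Set.inter_comm,
    Set.Ioc_inter_Iic, Real.volume_real_Ioc, inf_comm]
  simp only [sub_zero]
  exact max_eq_left (le_min hc zero_le_one)

lemma integrable_Ioc_ite_le (c : ℝ) :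
    MeasureTheory.Integrable (fun τ : ℝ => if τ ≤ c then (1 : ℝ) else 0)
      (MeasureTheory.volume.restrict (Set.Ioc (0 : ℝ) 1)) := by
  have h : (fun τ : ℝ => if τ ≤ c then (1 : ℝ) else 0) = (Set.Iic c).indicator 1 := by
    ext τ; simp [Set.indicator_apply]
  rw [h]
  exact (MeasureTheory.integrable_const (1 : ℝ)).indicator measurableSet_Iic

lemma integral_sum_card_filter {N : ℕ} (S : Finset ℤ) (F : ℕ → ℤ → ℝ) (hF : ∀ i x, 0 ≤ F i x) :
    MeasureTheory.IntegrableOn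
      (fun τ : ℝ => ((∑ i ∈ range N, #{x ∈ S | τ ≤ F i x} : ℕ) : ℝ)) (Set.Ioc (0 : ℝ) 1) ∧
    ∫ τ in Set.Ioc (0 : ℝ) 1, ((∑ i ∈ range N, #{x ∈ S | τ ≤ F i x} : ℕ) : ℝ) =
      ∑ i ∈ range N, ∑ x ∈ S, min (F i x) 1 := by
  have h : (fun τ : ℝ => ((∑ i ∈ range N, #{x ∈ S | τ ≤ F i x} : ℕ) : ℝ)) =
      fun τ => ∑ i ∈ range N, ∑ x ∈ S, if τ ≤ F i x then (1 : ℝ) else 0 := by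
    ext τ
    push_cast
    refine sum_congr rfl fun i _ => ?_
    rw [card_filter]
    push_cast
    rfl
  rw [h]
  have hI : ∀ i ∈ range N, MeasureTheory.Integrable
      (fun τ => ∑ x ∈ S, if τ ≤ F i x then (1 : ℝ) else 0)
      (MeasureTheory.volume.restrict (Set.Ioc (0 : ℝ) 1)) := fun i _ =>
    MeasureTheory.integrable_finsetSum _ fun x _ => integrable_Ioc_ite_le _
  refine ⟨MeasureTheory.integrable_finsetSum _ hI, ?_⟩
  rw [MeasureTheory.integral_finsetSum _ hI]
  refine sum_congr rfl fun i _ => ?_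
  rw [MeasureTheory.integral_finsetSum _ fun x _ => integrable_Ioc_ite_le _]
  exact sum_congr rfl fun x _ => setIntegral_Ioc_ite_le (hF i x)

/-- Layer-cake integration of `sum_card_level_le` over τ ∈ (0, 1], with level sets τ ≤ f² μ^{2i}, τ
≤ g² μ^{2i} and τ ≤ h μ^i: multiplying the first two conditions and taking a square root gives the
third, with levels added. A gain of N levels pays for the weight μ^N at `j₂`. The factor μ² comes
from `Q` being indexed from 1. -/
lemma geom_levels_le {X Y Z : Finset ℤ} {f g h : ℤ → ℝ} {N : ℕ} {j₁ j₂ : ℤ} {μ : ℝ}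
    (hN : 1 ≤ N) (hj : j₁ ≠ j₂) (hμ0 : 0 < μ) (hμ1 : μ ≤ 1)
    (hf : ∀ x, 0 ≤ f x) (hg : ∀ x, 0 ≤ g x) (hh : ∀ x, 0 ≤ h x)
    (hf1 : ∀ x ∈ X, f x ≤ 1) (hg1 : ∀ y ∈ Y, g y ≤ 1)
    (hX : ∃ x ∈ X, f x = 1) (hY : ∃ y ∈ Y, g y = 1)
    (h₁ : ∀ x ∈ X, ∀ y ∈ Y, 0 < f x → 0 < g y → x + y + j₁ ∈ Z ∧ f x * g y ≤ h (x + y + j₁))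
    (h₂ : ∀ x ∈ X, ∀ y ∈ Y, 0 < f x → 0 < g y →
      x + y + j₂ ∈ Z ∧ μ ^ N * (f x * g y) ≤ h (x + y + j₂)) :
    (∑ i ∈ range N, μ ^ (2 * i)) * (∑ x ∈ X, f x ^ 2 + μ ^ 2 * ∑ y ∈ Y, g y ^ 2) ≤
      (∑ i ∈ range N, μ ^ i) * ∑ z ∈ Z, h z := by
  set F : ℕ → ℤ → ℝ := fun i x => f x ^ 2 * μ ^ (2 * i) with hF
  set G : ℕ → ℤ → ℝ := fun i x => g x ^ 2 * μ ^ (2 * i) with hG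
  set H : ℕ → ℤ → ℝ := fun i z => h z * μ ^ i with hH
  have hpow : ∀ i, μ ^ i ≤ 1 := fun i => pow_le_one₀ hμ0.le hμ1
  have hlevel : ∀ τ ∈ Set.Ioc (0 : ℝ) 1,
      ((∑ i ∈ range N, #{x ∈ X | τ ≤ F i x} : ℕ) : ℝ) +
        ((∑ i ∈ range N, #{y ∈ Y | τ ≤ G (i + 1) y} : ℕ) : ℝ) ≤
        ((∑ i ∈ range N, #{z ∈ Z | τ ≤ H i z} : ℕ) : ℝ) := by
    rintro τ ⟨hτ0, hτ1⟩
    have hpos : ∀ u a, 0 ≤ a → τ ≤ a ^ 2 * μ ^ (2 * u) → 0 < a := by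
      intro u a ha h
      rcases ha.eq_or_lt with rfl | h'
      · norm_num at h; linarith
      · exact h'
    have hprod : ∀ u u' a b, 0 ≤ a → 0 ≤ b → τ ≤ a ^ 2 * μ ^ (2 * u) → τ ≤ b ^ 2 * μ ^ (2 * u') →
        τ ≤ (a * b) * μ ^ (u + u') := by
      intro u u' a b ha hb h1 h2
      have h3 : τ ^ 2 ≤ ((a * b) * μ ^ (u + u')) ^ 2 := by
        calc τ ^ 2 = τ * τ := sq τ
          _ ≤ (a ^ 2 * μ ^ (2 * u)) * (b ^ 2 * μ ^ (2 * u')) := by gcongr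
          _ = _ := by ring
      exact (pow_le_pow_iff_left₀ hτ0.le (by positivity) two_ne_zero).1 h3
    have key := sum_card_level_le (P := fun i => {x ∈ X | τ ≤ F i x})
      (Q := fun i => {y ∈ Y | τ ≤ G i y}) (R := fun i => {z ∈ Z | τ ≤ H i z}) hN hj ?_ ?_ ?_ ?_ ?_
    · exact_mod_cast key
    · intro i k hik x hx
      simp only [mem_filter] at hx ⊢
      refine ⟨hx.1, hx.2.trans ?_⟩
      exact mul_le_mul_of_nonneg_left (pow_le_pow_of_le_one hμ0.le hμ1 (by omega)) (sq_nonneg _)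
    · obtain ⟨x, hx, hx1⟩ := hX
      exact ⟨x, by simp [hx, hF, hx1, hτ1]⟩
    · obtain ⟨x, hx, hx1⟩ := hY
      exact ⟨x, by simp [hx, hG, hx1, hτ1]⟩
    · intro u u' x y hx hy
      simp only [mem_filter] at hx hy ⊢
      have h5 := h₁ x hx.1 y hy.1 (hpos u _ (hf x) hx.2) (hpos u' _ (hg y) hy.2)
      refine ⟨h5.1, (hprod u u' _ _ (hf x) (hg y) hx.2 hy.2).trans ?_⟩
      exact mul_le_mul_of_nonneg_right h5.2 (by positivity)
    · intro w u u' x y hw hx hy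
      simp only [mem_filter] at hx hy ⊢
      have hx0 := hpos u _ (hf x) hx.2
      have hy0 := hpos u' _ (hg y) hy.2
      have h5 := h₁ x hx.1 y hy.1 hx0 hy0
      have h6 := h₂ x hx.1 y hy.1 hx0 hy0
      have h7 := hprod u u' _ _ (hf x) (hg y) hx.2 hy.2
      have h8 : τ ≤ μ ^ N * (f x * g y) * μ ^ w := by
        rw [hw] at h7
        calc τ ≤ _ := h7
          _ = _ := by ring
      have h9 : μ ^ N * (f x * g y) ≤ f x * g y :=
        mul_le_of_le_one_left (by positivity) (hpow N)
      exact ⟨⟨h5.1, h8.trans (mul_le_mul_of_nonneg_right (h9.trans h5.2) (by positivity))⟩,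
        ⟨h6.1, h8.trans (mul_le_mul_of_nonneg_right h6.2 (by positivity))⟩⟩
  have hF0 : ∀ i x, 0 ≤ F i x := fun i x => by positivity
  have hG0 : ∀ i x, 0 ≤ G i x := fun i x => by positivity
  have hH0 : ∀ i x, 0 ≤ H i x := fun i x => mul_nonneg (hh x) (by positivity)
  obtain ⟨iF, eF⟩ := integral_sum_card_filter (N := N) X F hF0
  obtain ⟨iG, eG⟩ := integral_sum_card_filter (N := N) Y (fun i => G (i + 1)) (fun i => hG0 _)
  obtain ⟨iH, eH⟩ := integral_sum_card_filter (N := N) Z H hH0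
  have hint := MeasureTheory.setIntegral_mono_on (iF.add iG) iH measurableSet_Ioc hlevel
  simp only [Pi.add_apply] at hint
  rw [MeasureTheory.integral_add iF iG, eF, eG, eH] at hint
  have e1 : ∑ i ∈ range N, ∑ x ∈ X, min (F i x) 1 =
      (∑ i ∈ range N, μ ^ (2 * i)) * ∑ x ∈ X, f x ^ 2 := by
    rw [sum_mul_sum]
    refine sum_congr rfl fun i _ => sum_congr rfl fun x hx => ?_
    rw [min_eq_left, hF, mul_comm]
    exact mul_le_one₀ (pow_le_one₀ (hf x) (hf1 x hx)) (by positivity) (hpow _)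
  have e2 : ∑ i ∈ range N, ∑ x ∈ Y, min (G (i + 1) x) 1 =
      (∑ i ∈ range N, μ ^ (2 * i)) * (μ ^ 2 * ∑ y ∈ Y, g y ^ 2) := by
    rw [mul_sum, sum_mul_sum]
    refine sum_congr rfl fun i _ => sum_congr rfl fun x hx => ?_
    rw [min_eq_left, hG]
    · simp only; ring
    · exact mul_le_one₀ (pow_le_one₀ (hg x) (hg1 x hx)) (by positivity) (hpow _)
  have e3 : ∑ i ∈ range N, ∑ x ∈ Z, min (H i x) 1 ≤ (∑ i ∈ range N, μ ^ i) * ∑ z ∈ Z, h z := by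
    rw [sum_mul_sum]
    refine sum_le_sum fun i _ => sum_le_sum fun x hx => ?_
    rw [mul_comm]
    exact min_le_left _ _
  rw [mul_add]
  linarith

/-- Normalised form of the weighted one-dimensional Prékopa–Leindler inequality on `ℤ`. -/
lemma two_point_prekopa_leindler_normalized {X Y Z : Finset ℤ} {f g h : ℤ → ℝ} {j₁ j₂ : ℤ} {l : ℝ}
    (hj : j₁ ≠ j₂) (hl0 : 0 < l) (hl1 : l ≤ 1)
    (hf : ∀ x, 0 ≤ f x) (hg : ∀ x, 0 ≤ g x) (hh : ∀ x, 0 ≤ h x)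
    (hf1 : ∀ x ∈ X, f x ≤ 1) (hg1 : ∀ y ∈ Y, g y ≤ 1)
    (hX : ∃ x ∈ X, f x = 1) (hY : ∃ y ∈ Y, g y = 1)
    (h₁ : ∀ x ∈ X, ∀ y ∈ Y, 0 < f x → 0 < g y → x + y + j₁ ∈ Z ∧ f x * g y ≤ h (x + y + j₁))
    (h₂ : ∀ x ∈ X, ∀ y ∈ Y, 0 < f x → 0 < g y →
      x + y + j₂ ∈ Z ∧ l * (f x * g y) ≤ h (x + y + j₂)) :
    (1 + l) * (∑ x ∈ X, f x ^ 2 + ∑ y ∈ Y, g y ^ 2) ≤ 2 * ∑ z ∈ Z, h z := by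
  -- With μ the (N+1)-th root of l, the weight at `j₂` is exactly l, and the loss μ² disappears as N
  -- → ∞.
  have hroot : ∀ N : ℕ, (1 + l) * (∑ x ∈ X, f x ^ 2 +
      (l ^ ((N + 1 : ℝ)⁻¹)) ^ 2 * ∑ y ∈ Y, g y ^ 2) ≤ (1 + l ^ ((N + 1 : ℝ)⁻¹)) * ∑ z ∈ Z, h z := by
    intro N
    set μ := l ^ ((N + 1 : ℝ)⁻¹) with hμ
    have hμ0 : 0 < μ := Real.rpow_pos_of_pos hl0 _
    have hμ1 : μ ≤ 1 := Real.rpow_le_one hl0.le hl1 (by positivity)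
    have hμN : μ ^ (N + 1) = l := by
      rw [hμ, ← Real.rpow_natCast, ← Real.rpow_mul hl0.le]
      push_cast
      rw [inv_mul_cancel₀ (by positivity), Real.rpow_one]
    have key := geom_levels_le (N := N + 1) (by omega) hj hμ0 hμ1 hf hg hh hf1 hg1 hX hY h₁
      (by rw [hμN]; exact h₂)
    set S := ∑ i ∈ range (N + 1), μ ^ i with hS
    have hS0 : 0 < S := sum_pos (fun i _ => by positivity) ⟨0, by simp⟩
    have hgeo : (∑ i ∈ range (N + 1), μ ^ (2 * i)) * (1 + μ) = S * (1 + l) := by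
      rw [← hμN, hS]
      clear * -
      generalize N + 1 = n
      induction n with
      | zero => simp
      | succ n ih =>
        have hg := geom_sum_mul μ n
        rw [sum_range_succ, sum_range_succ, add_mul, ih]
        linear_combination (-(μ ^ n)) * hg
    refine le_of_mul_le_mul_left ?_ hS0
    calc S * ((1 + l) * _) = (1 + μ) * ((∑ i ∈ range (N + 1), μ ^ (2 * i)) *
          (∑ x ∈ X, f x ^ 2 + μ ^ 2 * ∑ y ∈ Y, g y ^ 2)) := by
            rw [← mul_assoc, ← hgeo]; ring
      _ ≤ (1 + μ) * (S * ∑ z ∈ Z, h z) := by gcongr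
      _ = _ := by ring
  have hlim : Filter.Tendsto (fun N : ℕ => l ^ ((N + 1 : ℝ)⁻¹)) Filter.atTop (nhds 1) := by
    have h0 : Filter.Tendsto (fun N : ℕ => (N + 1 : ℝ)⁻¹) Filter.atTop (nhds 0) := by
      simpa using tendsto_one_div_add_atTop_nhds_zero_nat (𝕜 := ℝ)
    simpa [Function.comp_def] using (Real.continuousAt_const_rpow hl0.ne').tendsto.comp h0
  have hL := (((hlim.pow 2).mul_const (∑ y ∈ Y, g y ^ 2)).const_add (∑ x ∈ X, f x ^ 2)).const_mul
    (1 + l)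
  have hR := (hlim.const_add 1).mul_const (∑ z ∈ Z, h z)
  have := le_of_tendsto_of_tendsto' hL hR hroot
  norm_num at this
  exact this

/-- A weighted one-dimensional Prékopa–Leindler inequality on `ℤ`, for weights `u₁`, `u₂` at two
points. -/
lemma two_point_prekopa_leindler {X Y Z : Finset ℤ} {f g h : ℤ → ℝ} {j₁ j₂ : ℤ} {u₁ u₂ : ℝ}
    (hj : j₁ ≠ j₂) (hu : 0 < u₂) (hu₁ : u₂ ≤ u₁)
    (hf : ∀ x, 0 ≤ f x) (hg : ∀ x, 0 ≤ g x) (hh : ∀ x, 0 ≤ h x)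
    (h₁ : ∀ x ∈ X, ∀ y ∈ Y, 0 < f x → 0 < g y →
      x + y + j₁ ∈ Z ∧ u₁ * (f x * g y) ≤ h (x + y + j₁))
    (h₂ : ∀ x ∈ X, ∀ y ∈ Y, 0 < f x → 0 < g y →
      x + y + j₂ ∈ Z ∧ u₂ * (f x * g y) ≤ h (x + y + j₂)) :
    (∑ x ∈ X, f x ^ 2) * (∑ y ∈ Y, g y ^ 2) * (u₁ + u₂) ^ 2 ≤ (∑ z ∈ Z, h z) ^ 2 := by
  have htriv : ∀ (S : Finset ℤ) (f : ℤ → ℝ), (∀ x, 0 ≤ f x) →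
      (∑ x ∈ S, f x ^ 2) = 0 ∨ ∃ M, 0 < M ∧ (∀ x ∈ S, f x ≤ M) ∧ ∃ x ∈ S, f x = M := by
    intro S f hf
    rcases S.eq_empty_or_nonempty with rfl | hS
    · simp
    obtain ⟨x, hx, hmax⟩ := S.exists_max_image f hS
    rcases (hf x).eq_or_lt with h | h
    · left
      refine sum_eq_zero fun y hy => ?_
      have := hmax y hy
      have := hf y
      have : f y = 0 := by linarith
      simp [this]
    · exact Or.inr ⟨f x, h, hmax, x, hx, rfl⟩
  rcases htriv X f hf with h0 | ⟨M, hM, hXM, x₀, hx₀, hfx₀⟩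
  · rw [h0]; simp; positivity
  rcases htriv Y g hg with h0 | ⟨L, hL, hYL, y₀, hy₀, hgy₀⟩
  · rw [h0]; simp; positivity
  have hu1 : 0 < u₁ := hu.trans_le hu₁
  have key := two_point_prekopa_leindler_normalized (X := X) (Y := Y) (Z := Z)
    (f := fun x => f x / M) (g := fun y => g y / L) (h := fun z => h z / (u₁ * M * L))
    (l := u₂ / u₁) hj (by positivity) ((div_le_one hu1).2 hu₁)
    (fun x => div_nonneg (hf x) hM.le) (fun x => div_nonneg (hg x) hL.le)
    (fun x => div_nonneg (hh x) (by positivity))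
    (fun x hx => (div_le_one hM).2 (hXM x hx)) (fun x hx => (div_le_one hL).2 (hYL x hx))
    ⟨x₀, hx₀, by simp [hfx₀, hM.ne']⟩ ⟨y₀, hy₀, by simp [hgy₀, hL.ne']⟩ ?_ ?_
  · simp only [div_pow, ← sum_div] at key
    set a := ∑ x ∈ X, f x ^ 2
    set b := ∑ y ∈ Y, g y ^ 2
    set c := ∑ z ∈ Z, h z
    have ha : 0 ≤ a := sum_nonneg fun _ _ => sq_nonneg _
    have hb : 0 ≤ b := sum_nonneg fun _ _ => sq_nonneg _
    have hk : (u₁ + u₂) * (a * L ^ 2 + b * M ^ 2) ≤ 2 * (M * L) * c := by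
      have h3 := mul_le_mul_of_nonneg_right key (by positivity : 0 ≤ u₁ * M ^ 2 * L ^ 2)
      field_simp at h3
      nlinarith [h3]
    have hsq := pow_le_pow_left₀ (by positivity) hk 2
    -- AM–GM turns the additive inequality for the normalised functions into the multiplicative one;
    -- the maxima M and L cancel.
    have hamgm : 4 * (M * L) ^ 2 * (a * b * (u₁ + u₂) ^ 2) ≤ 4 * (M * L) ^ 2 * c ^ 2 := by
      calc _ ≤ ((u₁ + u₂) * (a * L ^ 2 + b * M ^ 2)) ^ 2 := by
            nlinarith [mul_nonneg (sq_nonneg (u₁ + u₂)) (sq_nonneg (a * L ^ 2 - b * M ^ 2))]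
        _ ≤ _ := hsq
        _ = _ := by ring
    exact le_of_mul_le_mul_left hamgm (by positivity)
  · intro x hx y hy h3 h4
    have h3' : 0 < f x := by by_contra h; exact absurd h3 (by simp [le_antisymm (not_lt.1 h) (hf x)])
    have h4' : 0 < g y := by by_contra h; exact absurd h4 (by simp [le_antisymm (not_lt.1 h) (hg y)])
    have := h₁ x hx y hy h3' h4'
    refine ⟨this.1, ?_⟩
    rw [le_div_iff₀ (by positivity)]
    calc _ = u₁ * (f x * g y) := by field_simp
      _ ≤ _ := this.2
  · intro x hx y hy h3 h4
    have h3' : 0 < f x := by by_contra h; exact absurd h3 (by simp [le_antisymm (not_lt.1 h) (hf x)])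
    have h4' : 0 < g y := by by_contra h; exact absurd h4 (by simp [le_antisymm (not_lt.1 h) (hg y)])
    have := h₂ x hx y hy h3' h4'
    refine ⟨this.1, ?_⟩
    rw [le_div_iff₀ (by positivity)]
    calc _ = u₂ * (f x * g y) := by field_simp
      _ ≤ _ := this.2

/-! ### Adaptive separation by valuations, and expansion of products. -/

/-- `AdaptiveSplit v n S`: `S` is separated, up to elements on which all `v i` agree, by `n`
adaptive queries to the coordinates `v i`. -/
def AdaptiveSplit {ι α : Type*} (v : ι → α → ℤ) : ℕ → Finset α → Prop
  | 0, S => ∀ a ∈ S, ∀ b ∈ S, ∀ i, v i a = v i b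
  | n + 1, S => AdaptiveSplit v n S ∨ ∃ i, ∀ j, AdaptiveSplit v n {a ∈ S | v i a = j}

lemma AdaptiveSplit.mono {ι α : Type*} {v : ι → α → ℤ} {n m : ℕ} {S : Finset α}
    (h : AdaptiveSplit v n S) (hnm : n ≤ m) : AdaptiveSplit v m S := by
  induction hnm with
  | refl => exact h
  | step _ ih => exact Or.inl ih

/-- Adding a constant to a coordinate only relabels the answers to its queries. For valuations this
says that separation passes to dilates. -/
lemma AdaptiveSplit.comap {ι α β : Type*} {v : ι → α → ℤ} {v' : ι → β → ℤ} {n : ℕ}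
    {S : Finset α} {T : Finset β} (h : AdaptiveSplit v n S) (φ : β → α) (k : ι → ℤ)
    (hmem : ∀ b ∈ T, φ b ∈ S) (hv : ∀ b ∈ T, ∀ i, v' i b = v i (φ b) + k i) :
    AdaptiveSplit v' n T := by
  induction n generalizing S T with
  | zero =>
    intro a ha b hb i
    rw [hv a ha, hv b hb, h _ (hmem a ha) _ (hmem b hb) i]
  | succ n ih =>
    rcases h with h | ⟨i, h⟩
    · exact Or.inl (ih h hmem hv)
    · refine Or.inr ⟨i, fun j => ih (h (j - k i)) ?_ fun b hb => hv b (mem_filter.1 hb).1⟩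
      intro b hb
      rw [mem_filter] at hb ⊢
      exact ⟨hmem b hb.1, by rw [← hb.2, hv b hb.1]; ring⟩

lemma AdaptiveSplit.subset {ι α : Type*} {v : ι → α → ℤ} {n : ℕ} {S T : Finset α}
    (h : AdaptiveSplit v n S) (hT : T ⊆ S) : AdaptiveSplit v n T :=
  h.comap id (fun _ => 0) hT (by simp)

section Expansion

variable {G : Type*} [CommGroup G] [DecidableEq G]

/-- Multiplication by `A` expands products by a factor at least `g`. -/
def ProductExpands (A : Finset G) (g : ℕ) : Prop :=
  ∀ X Y : Finset G, #X * #Y * g ^ 2 ≤ #(X * Y * A) ^ 2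

lemma productExpands_one {A : Finset G} (hA : A.Nonempty) : ProductExpands A 1 := by
  intro X Y
  rcases X.eq_empty_or_nonempty with rfl | hX
  · simp
  rcases Y.eq_empty_or_nonempty with rfl | hY
  · simp
  have h1 : #X ≤ #(X * Y * A) := by
    rw [mul_assoc]; exact card_le_card_mul_right (hY.mul hA)
  have h2 : #Y ≤ #(X * Y * A) := by
    rw [mul_comm X, mul_assoc]; exact card_le_card_mul_right (hX.mul hA)
  rw [one_pow, mul_one, sq]
  exact Nat.mul_le_mul h1 h2

/-- The product of the fibres of X, Y, A over x, y, j lies in the fibre of XYA over x + y + j. Hence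
the square roots of the fibre sizes of X and Y, together with the fibre sizes of XYA, satisfy the
hypotheses of `two_point_prekopa_leindler` with weights g₁, g₂. -/
lemma ProductExpands.add_fibers {A : Finset G} {v : G → ℤ} (hv : ∀ x y, v (x * y) = v x + v y)
    {j₁ j₂ : ℤ} (hj : j₁ ≠ j₂) {g₁ g₂ : ℕ} (hg₂ : 0 < g₂) (hg : g₂ ≤ g₁)
    (h₁ : ProductExpands {a ∈ A | v a = j₁} g₁) (h₂ : ProductExpands {a ∈ A | v a = j₂} g₂) :
    ProductExpands A (g₁ + g₂) := by
  intro X Y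
  set W := X * Y * A with hW
  have hfib : ∀ S : Finset G,
      ∑ x ∈ S.image v, Real.sqrt (#{a ∈ S | v a = x} : ℝ) ^ 2 = (#S : ℝ) := by
    intro S
    rw [card_eq_sum_card_image v S]
    push_cast
    exact sum_congr rfl fun x _ => Real.sq_sqrt (by positivity)
  have hstep : ∀ (j : ℤ) (g : ℕ), 0 < g → ProductExpands {a ∈ A | v a = j} g → ∀ x y,
      0 < Real.sqrt (#{a ∈ X | v a = x} : ℝ) → 0 < Real.sqrt (#{a ∈ Y | v a = y} : ℝ) →
      x + y + j ∈ W.image v ∧ (g : ℝ) * (Real.sqrt (#{a ∈ X | v a = x} : ℝ) *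
        Real.sqrt (#{a ∈ Y | v a = y} : ℝ)) ≤ (#{a ∈ W | v a = x + y + j} : ℝ) := by
    intro j g hg0 hE x y hx hy
    have h3 := hE {a ∈ X | v a = x} {a ∈ Y | v a = y}
    have hsub : {a ∈ X | v a = x} * {a ∈ Y | v a = y} * {a ∈ A | v a = j} ⊆
        {a ∈ W | v a = x + y + j} := by
      intro z hz
      obtain ⟨t, ht, a, ha, rfl⟩ := mem_mul.1 hz
      obtain ⟨b, hb, c, hc, rfl⟩ := mem_mul.1 ht
      rw [mem_filter] at ha hb hc ⊢
      exact ⟨mul_mem_mul (mul_mem_mul hb.1 hc.1) ha.1, by rw [hv, hv, ha.2, hb.2, hc.2]⟩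
    have h4 := h3.trans (Nat.pow_le_pow_left (card_le_card hsub) 2)
    have h5 : (#{a ∈ X | v a = x} : ℝ) * #{a ∈ Y | v a = y} * g ^ 2 ≤
        (#{a ∈ W | v a = x + y + j} : ℝ) ^ 2 := by exact_mod_cast h4
    have h6 : (g : ℝ) * (Real.sqrt (#{a ∈ X | v a = x} : ℝ) *
        Real.sqrt (#{a ∈ Y | v a = y} : ℝ)) ≤ (#{a ∈ W | v a = x + y + j} : ℝ) := by
      rw [← pow_le_pow_iff_left₀ (by positivity) (by positivity) two_ne_zero]
      refine le_trans (le_of_eq ?_) h5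
      rw [mul_pow, mul_pow, Real.sq_sqrt (by positivity), Real.sq_sqrt (by positivity)]
      ring
    refine ⟨?_, h6⟩
    have h7 : (0 : ℝ) < #{a ∈ W | v a = x + y + j} :=
      lt_of_lt_of_le (by have : (0 : ℝ) < g := by exact_mod_cast hg0
                         positivity) h6
    obtain ⟨w, hw⟩ := card_pos.1 (by exact_mod_cast h7 : 0 < #{a ∈ W | v a = x + y + j})
    rw [mem_filter] at hw
    exact mem_image.2 ⟨w, hw.1, hw.2⟩
  have key := two_point_prekopa_leindler (X := X.image v) (Y := Y.image v) (Z := W.image v)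
    (f := fun x => Real.sqrt (#{a ∈ X | v a = x} : ℝ))
    (g := fun x => Real.sqrt (#{a ∈ Y | v a = x} : ℝ))
    (h := fun x => (#{a ∈ W | v a = x} : ℝ)) (u₁ := g₁) (u₂ := g₂) hj
    (by exact_mod_cast hg₂) (by exact_mod_cast hg) (fun _ => Real.sqrt_nonneg _)
    (fun _ => Real.sqrt_nonneg _) (fun _ => by positivity)
    (fun x _ y _ hx hy => hstep j₁ g₁ (hg₂.trans_le hg) h₁ x y hx hy)
    (fun x _ y _ hx hy => hstep j₂ g₂ hg₂ h₂ x y hx hy)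
  rw [hfib, hfib] at key
  have hWc : ∑ z ∈ W.image v, (#{a ∈ W | v a = z} : ℝ) = #W := by
    rw [card_eq_sum_card_image v W]; push_cast; rfl
  rw [hWc] at key
  exact_mod_cast key

/-- A finite set contains an adaptively split subset whose density and depth are controlled by a
factor by which the set expands products. -/
lemma exists_adaptiveSplit_subset {ι : Type*} {v : ι → G → ℤ}
    (hv : ∀ i x y, v i (x * y) = v i x + v i y) (A : Finset G) (hA : A.Nonempty) :
    ∃ (g n : ℕ) (A' : Finset G), 1 ≤ g ∧ ProductExpands A g ∧ A' ⊆ A ∧ AdaptiveSplit v n A' ∧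
      2 ^ n ≤ g ∧ #A ≤ #A' * g := by
  induction A using Finset.strongInduction with
  | H A ih =>
  by_cases hconst : AdaptiveSplit v 0 A
  · exact ⟨1, 0, A, le_rfl, productExpands_one hA, Subset.rfl, hconst, by simp, by simp⟩
  obtain ⟨a, ha, b, hb, i, hab⟩ : ∃ a ∈ A, ∃ b ∈ A, ∃ i, v i a ≠ v i b := by
    simpa [AdaptiveSplit] using hconst
  set J := A.image (v i) with hJ
  have hex : ∀ j, ∃ (g n : ℕ) (A' : Finset G), j ∈ J → 1 ≤ g ∧
      ProductExpands {a ∈ A | v i a = j} g ∧ A' ⊆ {a ∈ A | v i a = j} ∧ AdaptiveSplit v n A' ∧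
      2 ^ n ≤ g ∧ #{a ∈ A | v i a = j} ≤ #A' * g := by
    intro j
    by_cases hjJ : j ∈ J
    · obtain ⟨c, hc, rfl⟩ := mem_image.1 hjJ
      have hss : {x ∈ A | v i x = v i c} ⊂ A := by
        rw [filter_ssubset]
        by_contra! hcon
        exact hab ((hcon a ha).trans (hcon b hb).symm)
      obtain ⟨g, n, A', h⟩ := ih _ hss ⟨c, by simp [hc]⟩
      exact ⟨g, n, A', fun _ => h⟩
    · exact ⟨0, 0, ∅, fun h => absurd h hjJ⟩
  choose g n A' hgA using hex
  have haJ : v i a ∈ J := mem_image_of_mem _ ha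
  have hbJ : v i b ∈ J := mem_image_of_mem _ hb
  obtain ⟨j₁, hj₁, hmax₁⟩ := J.exists_max_image g ⟨_, haJ⟩
  have hne : (J.erase j₁).Nonempty := by
    by_cases h : v i a = j₁
    · exact ⟨v i b, mem_erase.2 ⟨fun h' => hab (h.trans h'.symm), hbJ⟩⟩
    · exact ⟨v i a, mem_erase.2 ⟨h, haJ⟩⟩
  obtain ⟨j₂, hj₂, hmax₂⟩ := (J.erase j₁).exists_max_image g hne
  obtain ⟨hj, hj₂J⟩ := mem_erase.1 hj₂
  obtain ⟨hg₁, hE₁, hs₁, ht₁, hp₁, hc₁⟩ := hgA j₁ hj₁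
  obtain ⟨hg₂, hE₂, -⟩ := hgA j₂ hj₂J
  have hexp := hE₁.add_fibers (hv i) hj.symm hg₂ (hmax₁ j₂ hj₂J) hE₂
  -- Either the subset found in the most expanding fibre is dense enough alone, or the union of the
  -- subsets from all other fibres is. That union needs one more query, which g₁ + g₂ ≥ 2g₂ allows.
  by_cases hbig : #A ≤ #(A' j₁) * (g j₁ + g j₂)
  · exact ⟨g j₁ + g j₂, n j₁, A' j₁, by omega, hexp, hs₁.trans (filter_subset _ _), ht₁, by omega,
      hbig⟩
  set R := (J.erase j₁).biUnion A' with hR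
  have hval : ∀ j ∈ J.erase j₁, ∀ x ∈ A' j, x ∈ A ∧ v i x = j := fun j hj x hx =>
    mem_filter.1 ((hgA j (mem_of_mem_erase hj)).2.2.1 hx)
  have hRA : R ⊆ A := by
    intro x hx
    obtain ⟨j, hj, hxj⟩ := mem_biUnion.1 hx
    exact (hval j hj x hxj).1
  have hfib : ∀ j, AdaptiveSplit v (Nat.log 2 (g j₂)) {x ∈ R | v i x = j} := by
    intro j
    by_cases hjm : j ∈ J.erase j₁
    · have h := hgA j (mem_of_mem_erase hjm)
      refine (h.2.2.2.1.mono ?_).subset (S := A' j) ?_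
      · refine Nat.le_log_of_pow_le (by norm_num) ?_
        exact h.2.2.2.2.1.trans (hmax₂ j hjm)
      · intro x hx
        obtain ⟨hxR, hxj⟩ := mem_filter.1 hx
        obtain ⟨k, hk, hxk⟩ := mem_biUnion.1 hxR
        rw [← hxj, (hval k hk x hxk).2]
        exact hxk
    · have : ({x ∈ R | v i x = j} : Finset G) = ∅ := by
        rw [filter_eq_empty_iff]
        intro x hx hxj
        obtain ⟨k, hk, hxk⟩ := mem_biUnion.1 hx
        rw [(hval k hk x hxk).2] at hxj
        exact hjm (hxj ▸ hk)
      rw [this]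
      exact AdaptiveSplit.mono (n := 0) (by simp [AdaptiveSplit]) (Nat.zero_le _)
  have hRcard : #R = ∑ j ∈ J.erase j₁, #(A' j) := by
    refine card_biUnion fun j hj k hk hjk => disjoint_left.2 fun x hxj hxk => ?_
    exact hjk ((hval j hj x hxj).2.symm.trans (hval k hk x hxk).2)
  have hAcard : #A = #{a ∈ A | v i a = j₁} + ∑ j ∈ J.erase j₁, #{a ∈ A | v i a = j} := by
    rw [add_sum_erase J (fun j => #{a ∈ A | v i a = j}) hj₁]
    exact card_eq_sum_card_image (v i) A
  have hrest : ∑ j ∈ J.erase j₁, #{a ∈ A | v i a = j} ≤ #R * g j₂ := by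
    rw [hRcard, sum_mul]
    refine sum_le_sum fun j hj => ?_
    exact (hgA j (mem_of_mem_erase hj)).2.2.2.2.2.trans (Nat.mul_le_mul_left _ (hmax₂ j hj))
  refine ⟨g j₁ + g j₂, Nat.log 2 (g j₂) + 1, R, by omega, hexp, hRA, Or.inr ⟨i, hfib⟩, ?_, ?_⟩
  · have := Nat.pow_log_le_self 2 (x := g j₂) (by omega)
    have := hmax₁ j₂ hj₂J
    rw [pow_succ]
    omega
  -- If both candidates were too small, |A| ≤ |A'_{j₁}| g₁ + |R| g₂ multiplied by g₁ + g₂ would give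
  -- |A|(g₁ + g₂) < |A|(g₁ + g₂).
  · by_contra! hcon
    push Not at hbig
    nlinarith

end Expansion

/-! ### A type 2 inequality in L^{2s}. -/

lemma pow_succ_tangent_le {A B : ℝ} (hA : 0 ≤ A) (hB : 0 ≤ B) (k : ℕ) :
    A ^ (k + 1) + (k + 1) * A ^ k * (B - A) ≤ B ^ (k + 1) := by
  induction k with
  | zero => simp
  | succ k ih =>
    have h := mul_le_mul_of_nonneg_left ih hB
    have h2 : 0 ≤ (k + 1 : ℝ) * A ^ k * (B - A) ^ 2 := by positivity
    push_cast
    calc _ = B * (A ^ (k + 1) + (k + 1) * A ^ k * (B - A)) - (k + 1 : ℝ) * A ^ k * (B - A) ^ 2 := by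
          ring
      _ ≤ B * B ^ (k + 1) := by linarith
      _ = _ := by ring

lemma pow_succ_le_tangent_add {A B M D : ℝ} (hA : 0 ≤ A) (hB : 0 ≤ B) (hAM : A ≤ M) (hBM : B ≤ M)
    (hD0 : 0 ≤ D) (hD : (B - A) ^ 2 ≤ D * M) (k : ℕ) :
    B ^ (k + 1) ≤ A ^ (k + 1) + (k + 1) * A ^ k * (B - A) + k * (k + 1) / 2 * D * M ^ k := by
  have hM : 0 ≤ M := hA.trans hAM
  induction k with
  | zero => simp
  | succ k ih =>
    have h := mul_le_mul_of_nonneg_left ih hB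
    have h2 : A ^ k * (B - A) ^ 2 ≤ M ^ k * (D * M) := by gcongr
    have h3 : B * (k * (k + 1) / 2 * D * M ^ k) ≤ M * (k * (k + 1) / 2 * D * M ^ k) := by gcongr
    have h4 := mul_le_mul_of_nonneg_left h2 (by positivity : (0 : ℝ) ≤ k + 1)
    push_cast
    calc B ^ (k + 1 + 1) = B * B ^ (k + 1) := by ring
      _ ≤ _ := h
      _ = A ^ (k + 1 + 1) + (k + 1 + 1) * A ^ (k + 1) * (B - A) + (k + 1) * (A ^ k * (B - A) ^ 2)
          + B * (k * (k + 1) / 2 * D * M ^ k) := by ring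
      _ ≤ A ^ (k + 1 + 1) + (k + 1 + 1) * A ^ (k + 1) * (B - A) + (k + 1) * (M ^ k * (D * M))
          + M * (k * (k + 1) / 2 * D * M ^ k) := by linarith
      _ = _ := by ring

lemma normSq_add_sub (x y : ℂ) :
    ‖x + y‖ ^ 2 - ‖x‖ ^ 2 = 2 * (starRingEnd ℂ x * y).re + ‖y‖ ^ 2 := by
  rw [← Complex.normSq_eq_norm_sq, ← Complex.normSq_eq_norm_sq, ← Complex.normSq_eq_norm_sq,
    Complex.normSq_add]
  simp [Complex.mul_re]
  ring

lemma norm_pow_add_re_le (x y : ℂ) (k : ℕ) :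
    ‖x‖ ^ (2 * (k + 1)) + 2 * (k + 1) * (‖x‖ ^ (2 * k) * (starRingEnd ℂ x * y).re) ≤
      ‖x + y‖ ^ (2 * (k + 1)) := by
  have h := pow_succ_tangent_le (sq_nonneg ‖x‖) (sq_nonneg ‖x + y‖) k
  rw [normSq_add_sub, ← pow_mul, ← pow_mul, ← pow_mul] at h
  have : 0 ≤ (k + 1) * ‖x‖ ^ (2 * k) * ‖y‖ ^ 2 := by positivity
  linarith

/-- Second-order Taylor bound for t^{k+1} between t = ‖x‖² and t = ‖x + y‖². The term linear in y is
kept exact, since orthogonality will remove it on integration. -/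
lemma norm_add_pow_le (x y : ℂ) (k : ℕ) :
    ‖x + y‖ ^ (2 * (k + 1)) ≤
      ‖x‖ ^ (2 * (k + 1)) + 2 * (k + 1) * (‖x‖ ^ (2 * k) * (starRingEnd ℂ x * y).re) +
      (k + 1) * (2 * k + 1) * (‖y‖ ^ 2 * ‖x‖ ^ (2 * k) + ‖y‖ ^ 2 * ‖x + y‖ ^ (2 * k)) := by
  set A := ‖x‖ ^ 2 with hA
  set B := ‖x + y‖ ^ 2 with hB
  have hA0 : 0 ≤ A := sq_nonneg _
  have hB0 : 0 ≤ B := sq_nonneg _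
  have hD : (B - A) ^ 2 ≤ (4 * ‖y‖ ^ 2) * max A B := by
    have h1 : |‖x + y‖ - ‖x‖| ≤ ‖y‖ := by
      have := abs_norm_sub_norm_le (x + y) x
      simpa using this
    have h2 : (‖x + y‖ - ‖x‖) ^ 2 ≤ ‖y‖ ^ 2 := sq_le_sq.2 (by simpa using h1)
    have h3 : (‖x + y‖ + ‖x‖) ^ 2 ≤ 4 * max A B := by
      have := le_max_left A B
      have := le_max_right A B
      nlinarith [sq_nonneg (‖x + y‖ - ‖x‖)]
    calc (B - A) ^ 2 = (‖x + y‖ - ‖x‖) ^ 2 * (‖x + y‖ + ‖x‖) ^ 2 := by rw [hA, hB]; ring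
      _ ≤ ‖y‖ ^ 2 * (4 * max A B) := by gcongr
      _ = _ := by ring
  have h := pow_succ_le_tangent_add hA0 hB0 (le_max_left A B) (le_max_right A B) (by positivity)
    hD k
  rw [show B - A = _ from normSq_add_sub x y] at h
  have hM : (max A B) ^ k ≤ A ^ k + B ^ k := by
    rcases max_cases A B with h' | h' <;> rw [h'.1]
    · linarith [pow_nonneg hB0 k]
    · linarith [pow_nonneg hA0 k]
  have hM' := mul_le_mul_of_nonneg_left hM
    (by positivity : (0 : ℝ) ≤ k * (k + 1) / 2 * (4 * ‖y‖ ^ 2))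
  have h5 : 0 ≤ (k + 1) * ‖y‖ ^ 2 * B ^ k := by positivity
  rw [pow_mul, pow_mul, pow_mul, pow_mul, ← hA, ← hB]
  nlinarith

/-- The unit-period measure. -/
noncomputable abbrev unitMeasure : Measure ℝ := volume.restrict (Set.Ico (0 : ℝ) 1)

/-- The square of the `L^{2s}` norm over a unit period. -/
noncomputable def sqNorm (s : ℕ) (f : ℝ → ℂ) : ℝ :=
  (∫ α, ‖f α‖ ^ (2 * s) ∂unitMeasure) ^ ((s : ℝ)⁻¹)

lemma sqNorm_nonneg (s : ℕ) (f : ℝ → ℂ) : 0 ≤ sqNorm s f :=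
  Real.rpow_nonneg (integral_nonneg fun _ => by positivity) _

lemma sqNorm_pow {s : ℕ} (hs : s ≠ 0) (f : ℝ → ℂ) :
    sqNorm s f ^ s = ∫ α, ‖f α‖ ^ (2 * s) ∂unitMeasure :=
  Real.rpow_inv_natCast_pow (integral_nonneg fun _ => by positivity) hs

lemma integrable_unitMeasure {E : Type*} [NormedAddCommGroup E] {f : ℝ → E} (hf : Continuous f) :
    Integrable f unitMeasure :=
  (hf.integrableOn_Icc (a := 0) (b := 1)).mono_set Set.Ico_subset_Icc_self

lemma memLp_unitMeasure {E : Type*} [NormedAddCommGroup E] [SecondCountableTopology E]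
    {f : ℝ → E} (hf : Continuous f) (p : ENNReal) : MemLp f p unitMeasure := by
  obtain ⟨C, hC⟩ := isCompact_Icc.exists_bound_of_continuousOn (hf.continuousOn (s := Set.Icc 0 1))
  refine MemLp.of_bound hf.aestronglyMeasurable C ?_
  filter_upwards [ae_restrict_mem measurableSet_Ico] with x hx
  exact hC x (Set.Ico_subset_Icc_self hx)

lemma lpNorm_sq_eq_sqNorm {s : ℕ} (hs : s ≠ 0) {f : ℝ → ℂ} (hf : Continuous f) :
    lpNorm f ((2 * s : ℕ) : ENNReal) unitMeasure ^ 2 = sqNorm s f := by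
  rw [lpNorm_eq_integral_norm_rpow_toReal (by simp [hs]) (ENNReal.natCast_ne_top _)
    hf.aestronglyMeasurable, sqNorm]
  simp only [ENNReal.toReal_natCast, Real.rpow_natCast]
  rw [← Real.rpow_natCast, ← Real.rpow_mul (integral_nonneg fun _ => by positivity)]
  congr 1
  have : (s : ℝ) ≠ 0 := by exact_mod_cast hs
  push_cast
  field_simp

lemma sqNorm_sum_le {s : ℕ} (hs : s ≠ 0) {ι : Type*} (I : Finset ι) {f : ι → ℝ → ℂ}
    (hf : ∀ i ∈ I, Continuous (f i)) :
    sqNorm s (fun α => ∑ i ∈ I, f i α) ≤ #I * ∑ i ∈ I, sqNorm s (f i) := by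
  have hfun : (fun α => ∑ i ∈ I, f i α) = ∑ i ∈ I, f i := by ext; simp
  have h1 := lpNorm_sum_le (p := ((2 * s : ℕ) : ENNReal)) (μ := unitMeasure) (s := I) (f := f)
    (fun i hi => memLp_unitMeasure (hf i hi) _) (by exact_mod_cast (by omega : 1 ≤ 2 * s))
  have hc : Continuous (fun α => ∑ i ∈ I, f i α) := continuous_finsetSum _ hf
  rw [← lpNorm_sq_eq_sqNorm hs hc, hfun]
  calc _ ≤ (∑ i ∈ I, lpNorm (f i) ((2 * s : ℕ) : ENNReal) unitMeasure) ^ 2 :=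
        pow_le_pow_left₀ lpNorm_nonneg h1 2
    _ ≤ #I * ∑ i ∈ I, lpNorm (f i) ((2 * s : ℕ) : ENNReal) unitMeasure ^ 2 :=
        sq_sum_le_card_mul_sum_sq
    _ = _ := by
        congr 1
        exact sum_congr rfl fun i hi => lpNorm_sq_eq_sqNorm hs (hf i hi)

lemma integral_norm_sq_mul_norm_pow_le {k : ℕ} {f g : ℝ → ℂ} (hf : Continuous f)
    (hg : Continuous g) :
    ∫ α, ‖g α‖ ^ 2 * ‖f α‖ ^ (2 * k) ∂unitMeasure ≤
      sqNorm (k + 1) g * sqNorm (k + 1) f ^ k := by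
  rcases Nat.eq_zero_or_pos k with rfl | hk
  · simp [sqNorm]
  have hk' : (0 : ℝ) < k := by exact_mod_cast hk
  have hpq : ((k + 1 : ℕ) : ℝ).HolderConjugate (((k + 1 : ℕ) : ℝ) / k) := by
    rw [Real.holderConjugate_iff]
    push_cast
    refine ⟨by linarith, ?_⟩
    field_simp
    ring
  have h := integral_mul_le_Lp_mul_Lq_of_nonneg (μ := unitMeasure) hpq
    (f := fun α => ‖g α‖ ^ 2) (g := fun α => ‖f α‖ ^ (2 * k))
    (Filter.Eventually.of_forall fun _ => by positivity)
    (Filter.Eventually.of_forall fun _ => by positivity)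
    (memLp_unitMeasure (by fun_prop) _) (memLp_unitMeasure (by fun_prop) _)
  refine h.trans (le_of_eq ?_)
  congr 1
  · rw [sqNorm, one_div]
    congr 2
    ext α
    rw [Real.rpow_natCast, ← pow_mul]
  · rw [sqNorm, ← Real.rpow_natCast,
      ← Real.rpow_mul (integral_nonneg fun _ => by positivity)]
    congr 1
    · congr 1
      ext α
      rw [← Real.rpow_natCast, ← Real.rpow_mul (norm_nonneg _), ← Real.rpow_natCast]
      congr 1
      push_cast
      field_simp
    · push_cast
      field_simp

/-- A form of type 2 for `L^{2s}`: adding a function orthogonal to `|f|^{2s-2} f`. -/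
lemma sqNorm_add_le_of_orthogonal {k : ℕ} {f g : ℝ → ℂ} (hf : Continuous f) (hg : Continuous g)
    (horth : ∫ α, (‖f α‖ ^ (2 * k) : ℝ) * (starRingEnd ℂ (f α) * g α) ∂unitMeasure = 0) :
    sqNorm (k + 1) (fun α => f α + g α) ≤
      sqNorm (k + 1) f + 2 * ((k + 1) * (2 * k + 1)) * sqNorm (k + 1) g := by
  have hre : ∫ α, ‖f α‖ ^ (2 * k) * (starRingEnd ℂ (f α) * g α).re ∂unitMeasure = 0 := by
    have hI : Integrable (fun α => ((‖f α‖ ^ (2 * k) : ℝ) : ℂ) * (starRingEnd ℂ (f α) * g α))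
        unitMeasure := integrable_unitMeasure (by fun_prop)
    have h := integral_re hI
    simp only [RCLike.re_eq_complex_re, horth, Complex.zero_re, Complex.re_ofReal_mul] at h
    exact h
  have hfg : Continuous (fun α => f α + g α) := hf.add hg
  set P := sqNorm (k + 1) f with hP
  set Q := sqNorm (k + 1) g with hQ
  set T := sqNorm (k + 1) (fun α => f α + g α) with hT
  have hP0 : 0 ≤ P := sqNorm_nonneg _ _
  have hQ0 : 0 ≤ Q := sqNorm_nonneg _ _
  have hT0 : 0 ≤ T := sqNorm_nonneg _ _
  have iA : Integrable (fun α => ‖f α‖ ^ (2 * (k + 1))) unitMeasure :=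
    integrable_unitMeasure (by fun_prop)
  have iB : Integrable (fun α => 2 * (k + 1 : ℝ) *
      (‖f α‖ ^ (2 * k) * (starRingEnd ℂ (f α) * g α).re)) unitMeasure :=
    integrable_unitMeasure (by fun_prop)
  have iC : Integrable (fun α => ‖g α‖ ^ 2 * ‖f α‖ ^ (2 * k)) unitMeasure :=
    integrable_unitMeasure (by fun_prop)
  have iD : Integrable (fun α => ‖g α‖ ^ 2 * ‖f α + g α‖ ^ (2 * k)) unitMeasure :=
    integrable_unitMeasure (by fun_prop)
  have iT : Integrable (fun α => ‖f α + g α‖ ^ (2 * (k + 1))) unitMeasure :=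
    integrable_unitMeasure (by fun_prop)
  -- Convexity and orthogonality: adding g cannot decrease the norm. This permits replacing P^k by
  -- T^k in the upper bound and dividing by T^k.
  have hlow : P ^ (k + 1) ≤ T ^ (k + 1) := by
    rw [hP, hT, sqNorm_pow (by omega), sqNorm_pow (by omega)]
    have := integral_mono (iA.add iB) iT fun α => norm_pow_add_re_le (f α) (g α) k
    simp only [Pi.add_apply] at this
    rwa [integral_add iA iB, integral_const_mul, hre, mul_zero, add_zero] at this
  have hPT : P ≤ T := (pow_le_pow_iff_left₀ hP0 hT0 (by omega)).1 hlow
  have hup : T ^ (k + 1) ≤ P ^ (k + 1) + (k + 1) * (2 * k + 1) * (Q * P ^ k + Q * T ^ k) := by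
    have := integral_mono iT ((iA.add iB).add ((iC.add iD).const_mul ((k + 1) * (2 * k + 1))))
      fun α => norm_add_pow_le (f α) (g α) k
    rw [integral_add' (iA.add iB) ((iC.add iD).const_mul _), integral_add' iA iB,
      integral_const_mul, hre, mul_zero, add_zero, integral_const_mul, integral_add' iC iD,
      ← sqNorm_pow (by omega), ← sqNorm_pow (by omega)] at this
    refine this.trans ?_
    gcongr
    · exact integral_norm_sq_mul_norm_pow_le hf hg
    · exact integral_norm_sq_mul_norm_pow_le hfg hg
  rcases hT0.eq_or_lt with h0 | hTpos
  · rw [← h0]; positivity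
  have hTk : 0 < T ^ k := by positivity
  have hPk : P ^ k ≤ T ^ k := pow_le_pow_left₀ hP0 hPT k
  refine le_of_mul_le_mul_left ?_ hTk
  have h1 : P ^ (k + 1) ≤ T ^ k * P := by rw [pow_succ]; gcongr
  have h2 : Q * P ^ k ≤ Q * T ^ k := by gcongr
  have h3 := mul_le_mul_of_nonneg_left h2 (by positivity : (0 : ℝ) ≤ (k + 1) * (2 * k + 1))
  calc T ^ k * T = T ^ (k + 1) := (pow_succ _ _).symm
    _ ≤ _ := hup
    _ ≤ T ^ k * P + (k + 1) * (2 * k + 1) * (Q * T ^ k + Q * T ^ k) := by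
      linarith
    _ = _ := by ring

/-! ### Exponential sums and orthogonality through divisibility of frequencies. -/

lemma continuous_addChar : Continuous addChar := by
  unfold addChar; fun_prop

lemma addChar_add (x y : ℝ) : addChar (x + y) = addChar x * addChar y := by
  rw [addChar, addChar, addChar, ← Complex.exp_add]; push_cast; ring_nf

lemma norm_addChar (x : ℝ) : ‖addChar x‖ = 1 := by
  rw [addChar, show (2 * Real.pi * Complex.I * x : ℂ) = ((2 * Real.pi * x : ℝ) : ℂ) * Complex.I by
    push_cast; ring, Complex.norm_exp_ofReal_mul_I]

lemma addChar_eq_one_iff {x : ℝ} : addChar x = 1 ↔ ∃ n : ℤ, x = n := by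
  have hpi : (2 * Real.pi * Complex.I : ℂ) ≠ 0 := Complex.two_pi_I_ne_zero
  rw [addChar, Complex.exp_eq_one_iff]
  refine exists_congr fun n => ?_
  rw [mul_comm, mul_left_inj' hpi]
  exact_mod_cast Iff.rfl

lemma addChar_int (n : ℤ) : addChar n = 1 := addChar_eq_one_iff.2 ⟨n, rfl⟩

/-- The exponential sum `∑_{a ∈ B} w(a) e(α n(a))`. -/
noncomputable def expSum (B : Finset ℤ) (w : ℤ → ℝ) (n : ℤ → ℤ) (α : ℝ) : ℂ :=
  ∑ a ∈ B, (w a : ℂ) * addChar (α * (n a : ℝ))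

lemma continuous_expSum (B : Finset ℤ) (w : ℤ → ℝ) (n : ℤ → ℤ) : Continuous (expSum B w n) :=
  continuous_finsetSum _ fun _ _ =>
    continuous_const.mul (continuous_addChar.comp (continuous_id.mul continuous_const))

lemma expSum_add_of_dvd {B : Finset ℤ} {w : ℤ → ℝ} {n : ℤ → ℤ} {q : ℤ} (hq : q ≠ 0)
    (h : ∀ a ∈ B, q ∣ n a) (α : ℝ) : expSum B w n (α + (q : ℝ)⁻¹) = expSum B w n α := by
  refine sum_congr rfl fun a ha => ?_
  obtain ⟨m, hm⟩ := h a ha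
  have hq' : (q : ℝ) ≠ 0 := by exact_mod_cast hq
  rw [add_mul, addChar_add, hm]
  push_cast
  rw [inv_mul_cancel_left₀ hq', addChar_int, mul_one]

lemma expSum_periodic (B : Finset ℤ) (w : ℤ → ℝ) (n : ℤ → ℤ) :
    Function.Periodic (expSum B w n) 1 := fun α => by
  simpa using expSum_add_of_dvd (B := B) (w := w) (n := n) one_ne_zero (fun _ _ => one_dvd _) α

/-- The shift α ↦ α + 1/q preserves the integral over a period but multiplies it by e(m/q) ≠ 1. -/
lemma integral_mul_addChar_eq_zero {Φ : ℝ → ℂ} {q m : ℤ} (hq : q ≠ 0) (hm : ¬ q ∣ m)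
    (hper : Function.Periodic Φ 1) (hq_per : ∀ α, Φ (α + (q : ℝ)⁻¹) = Φ α) :
    ∫ α, Φ α * addChar (α * (m : ℝ)) ∂unitMeasure = 0 := by
  set F : ℝ → ℂ := fun α => Φ α * addChar (α * (m : ℝ)) with hF
  have hFper : Function.Periodic F 1 := fun α => by
    simp only [hF]
    rw [hper, add_mul, addChar_add, one_mul, addChar_int, mul_one]
  have hI : ∫ α, F α ∂unitMeasure = ∫ α in (0 : ℝ)..1, F α := by
    rw [intervalIntegral.integral_of_le zero_le_one]
    exact integral_Ico_eq_integral_Ioc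
  have h1 : ∫ α in (0 : ℝ)..1, F (α + (q : ℝ)⁻¹) = ∫ α in (0 : ℝ)..1, F α := by
    rw [intervalIntegral.integral_comp_add_right]
    have := hFper.intervalIntegral_add_eq (0 + (q : ℝ)⁻¹) 0
    simpa [add_comm] using this
  have h2 : ∫ α in (0 : ℝ)..1, F (α + (q : ℝ)⁻¹) =
      addChar ((q : ℝ)⁻¹ * m) * ∫ α in (0 : ℝ)..1, F α := by
    rw [← intervalIntegral.integral_const_mul]
    congr 1
    ext α
    simp only [hF]
    rw [hq_per, add_mul, addChar_add]
    ring
  rw [hI]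
  by_contra hne
  rw [h1] at h2
  have h3 : addChar ((q : ℝ)⁻¹ * m) = 1 := by
    refine mul_right_cancel₀ hne ?_
    rw [← h2, one_mul]
  obtain ⟨t, ht⟩ := addChar_eq_one_iff.1 h3
  refine hm ⟨t, ?_⟩
  have hq' : (q : ℝ) ≠ 0 := by exact_mod_cast hq
  have : (m : ℝ) = q * t := by rw [← ht, mul_inv_cancel_left₀ hq']
  exact_mod_cast this

lemma expSum_union {B B' : Finset ℤ} (h : Disjoint B B') (w : ℤ → ℝ) (n : ℤ → ℤ) :
    expSum (B ∪ B') w n = fun α => expSum B w n α + expSum B' w n α := by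
  ext α; exact sum_union h

lemma sqNorm_expSum_union_le {k : ℕ} {B B' : Finset ℤ} {n : ℤ → ℤ} {q : ℤ} (w : ℤ → ℝ) (hq : q ≠ 0)
    (hB : ∀ a ∈ B, q ∣ n a) (hB' : ∀ a ∈ B', ¬ q ∣ n a) :
    sqNorm (k + 1) (expSum (B ∪ B') w n) ≤
      sqNorm (k + 1) (expSum B w n) + 2 * ((k + 1) * (2 * k + 1)) * sqNorm (k + 1) (expSum B' w n) := by
  have hdisj : Disjoint B B' := disjoint_left.2 fun a h h' => hB' a h' (hB a h)
  rw [expSum_union hdisj]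
  refine sqNorm_add_le_of_orthogonal (continuous_expSum _ _ _) (continuous_expSum _ _ _) ?_
  have hf := continuous_expSum B w n
  have hΦ : Continuous fun α => ((‖expSum B w n α‖ ^ (2 * k) : ℝ) : ℂ) *
      starRingEnd ℂ (expSum B w n α) := by fun_prop
  have hexp : (fun α => ((‖expSum B w n α‖ ^ (2 * k) : ℝ) : ℂ) *
      (starRingEnd ℂ (expSum B w n α) * expSum B' w n α)) = fun α => ∑ a ∈ B', (w a : ℂ) *
        ((((‖expSum B w n α‖ ^ (2 * k) : ℝ) : ℂ) * starRingEnd ℂ (expSum B w n α)) *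
          addChar (α * (n a : ℝ))) := by
    ext α
    rw [← mul_assoc]
    conv_lhs => enter [2]; rw [expSum]
    rw [mul_sum]
    exact sum_congr rfl fun a _ => by ring
  rw [hexp, integral_finsetSum]
  · refine sum_eq_zero fun a ha => ?_
    rw [integral_const_mul, integral_mul_addChar_eq_zero hq (hB' a ha), mul_zero]
    · intro α
      simp only [expSum_periodic B w n α]
    · intro α
      simp only [expSum_add_of_dvd hq hB]
  · intro a _
    exact integrable_unitMeasure (continuous_const.mul (hΦ.mul
      (continuous_addChar.comp (continuous_id.mul continuous_const))))

lemma sqNorm_expSum_empty {s : ℕ} (hs : s ≠ 0) (w : ℤ → ℝ) (n : ℤ → ℤ) :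
    sqNorm s (expSum ∅ w n) = 0 := by
  have : (s : ℝ)⁻¹ ≠ 0 := by positivity
  simp [sqNorm, expSum, hs]

/-- Levels are split off from the lowest upwards. At each step the sum over the higher levels keeps
coefficient 1 and only the single level pays the constant, so constants do not compound with the
number of levels. -/
lemma sqNorm_expSum_levels_le {k : ℕ} {B : Finset ℤ} {n v : ℤ → ℤ} (w : ℤ → ℝ) (J : Finset ℤ)
    (hJ : ∀ j ∈ J, ∃ q : ℤ, q ≠ 0 ∧ (∀ a ∈ B, v a = j → ¬ q ∣ n a) ∧
      ∀ a ∈ B, j < v a → q ∣ n a) :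
    sqNorm (k + 1) (expSum {a ∈ B | v a ∈ J} w n) ≤
      2 * ((k + 1) * (2 * k + 1)) * ∑ j ∈ J, sqNorm (k + 1) (expSum {a ∈ B | v a = j} w n) := by
  induction J using Finset.induction_on_min with
  | empty => simp [sqNorm_expSum_empty]
  | insert j J hlt ih =>
    obtain ⟨q, hq, h1, h2⟩ := hJ j (mem_insert_self _ _)
    have hj : j ∉ J := fun h => (hlt j h).false
    have hU : ({a ∈ B | v a ∈ insert j J} : Finset ℤ) = {a ∈ B | v a ∈ J} ∪ {a ∈ B | v a = j} := by
      ext a; simp only [mem_filter, mem_insert, mem_union]; tauto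
    rw [hU, sum_insert hj]
    have h3 := sqNorm_expSum_union_le (k := k) (B := {a ∈ B | v a ∈ J}) (B' := {a ∈ B | v a = j})
      (n := n) w hq ?_ ?_
    · have := ih fun i hi => hJ i (mem_insert_of_mem hi)
      linarith
    · intro a ha
      rw [mem_filter] at ha
      exact h2 a ha.1 (hlt _ ha.2)
    · intro a ha
      rw [mem_filter] at ha
      exact h1 a ha.1 ha.2

/-- Allows φ(a) - φ(0) to replace φ(a), so that the constant term does not affect valuations. -/
lemma sqNorm_expSum_sub_const (s : ℕ) (B : Finset ℤ) (w : ℤ → ℝ) (n : ℤ → ℤ) (c : ℤ) :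
    sqNorm s (expSum B w (fun a => n a - c)) = sqNorm s (expSum B w n) := by
  have h : ∀ α, expSum B w n α = addChar (α * c) * expSum B w (fun a => n a - c) α := by
    intro α
    rw [expSum, expSum, mul_sum]
    refine sum_congr rfl fun a _ => ?_
    rw [mul_left_comm, ← addChar_add]
    push_cast
    ring_nf
  unfold sqNorm
  congr 2
  ext α
  rw [h, norm_mul, norm_addChar, one_mul]

/-! ### Valuations of polynomial values, and the cost of one query. -/

/-- Outside few exceptional values `j`, the `p`-adic valuation of `φ(a) - φ(0)` for `v_p(a) = j` is
a constant, which is smaller than all valuations arising from `v_p(a) > j`. -/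
lemma exists_exceptional_valuations {φ : Polynomial ℤ} {d : ℕ} (hd : 1 ≤ d) (hφ : φ.natDegree = d)
    (p : ℕ) [hp : Fact p.Prime] :
    ∃ E : Finset ℤ, #E ≤ d ^ 2 ∧ ∀ j : ℤ, j ∉ E → 0 ≤ j → ∃ q : ℤ, q ≠ 0 ∧
      (∀ a : ℤ, a ≠ 0 → (padicValInt p a : ℤ) = j → ¬ q ∣ φ.eval a - φ.coeff 0) ∧
      ∀ a : ℤ, a ≠ 0 → j < (padicValInt p a : ℤ) → q ∣ φ.eval a - φ.coeff 0 := by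
  set c : ℕ → ℤ := fun i => φ.coeff (i + 1) with hc
  -- These are the Newton polygon slopes: two nonzero terms c_i a^{i+1} can tie in valuation at
  -- v_p(a) = j only if j is such a quotient. Inexact quotients and zero coefficients merely add
  -- harmless values.
  refine ⟨((range d) ×ˢ (range d)).image fun x =>
    ((padicValInt p (c x.1) : ℤ) - padicValInt p (c x.2)) / ((x.2 : ℤ) - x.1), ?_, ?_⟩
  · refine card_image_le.trans ?_
    simp [sq]
  intro j hjE hj0
  lift j to ℕ using hj0
  set S := {i ∈ range d | c i ≠ 0} with hS
  have hSne : S.Nonempty := by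
    refine ⟨d - 1, mem_filter.2 ⟨mem_range.2 (by omega), ?_⟩⟩
    simp only [hc]
    rw [show d - 1 + 1 = φ.natDegree by omega]
    intro h
    have := Polynomial.leadingCoeff_eq_zero.1 h
    rw [this] at hφ
    simp at hφ
    omega
  obtain ⟨i₀, hi₀, hmin⟩ := S.exists_min_image (fun i => padicValInt p (c i) + (i + 1) * j) hSne
  set M := padicValInt p (c i₀) + (i₀ + 1) * j with hM
  rw [hS, mem_filter, mem_range] at hi₀
  have hvpow : ∀ a : ℤ, a ≠ 0 → ∀ i : ℕ, padicValInt p (a ^ i) = i * padicValInt p a := by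
    intro a ha i
    induction i with
    | zero => simp
    | succ i ih => rw [pow_succ, padicValInt.mul (pow_ne_zero _ ha) ha, ih]; ring
  have hterm : ∀ a : ℤ, a ≠ 0 → ∀ i, c i ≠ 0 → padicValInt p (c i * a ^ (i + 1)) =
      padicValInt p (c i) + (i + 1) * padicValInt p a := by
    intro a ha i hi
    rw [padicValInt.mul hi (pow_ne_zero _ ha), hvpow a ha]
  have heval : ∀ a : ℤ, φ.eval a - φ.coeff 0 = ∑ i ∈ range d, c i * a ^ (i + 1) := by
    intro a
    rw [Polynomial.eval_eq_sum_range, hφ, sum_range_succ']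
    simp [hc]
  have hlt : ∀ i ∈ range d, c i ≠ 0 → i ≠ i₀ → M < padicValInt p (c i) + (i + 1) * j := by
    intro i hi hci hne
    refine lt_of_le_of_ne (hmin i (mem_filter.2 ⟨hi, hci⟩)) fun heq => hjE ?_
    refine mem_image.2 ⟨(i₀, i), mem_product.2 ⟨mem_range.2 hi₀.1, hi⟩, ?_⟩
    have hne' : (i : ℤ) - i₀ ≠ 0 := by
      have : (i : ℤ) ≠ i₀ := by exact_mod_cast hne
      omega
    refine Int.ediv_eq_of_eq_mul_left hne' ?_
    have : (M : ℤ) = padicValInt p (c i) + (i + 1) * j := by exact_mod_cast heq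
    rw [hM] at this
    push_cast at this
    linarith
  -- M is the minimal term valuation at level j, attained only at i₀, so p^{M+1} fails to divide the
  -- sum there. Every exponent i + 1 is positive, so raising v_p(a) raises each term's valuation
  -- above M.
  refine ⟨(p : ℤ) ^ (M + 1), pow_ne_zero _ (by exact_mod_cast hp.out.ne_zero), ?_, ?_⟩
  · intro a ha haj hdvd
    have haj' : padicValInt p a = j := by exact_mod_cast haj
    rw [heval, ← add_sum_erase _ _ (mem_range.2 hi₀.1)] at hdvd
    have hrest : (p : ℤ) ^ (M + 1) ∣ ∑ i ∈ (range d).erase i₀, c i * a ^ (i + 1) := by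
      refine dvd_sum fun i hi => ?_
      obtain ⟨hne, hi⟩ := mem_erase.1 hi
      by_cases hci : c i = 0
      · simp [hci]
      rw [padicValInt_dvd_iff, hterm a ha i hci, haj']
      exact Or.inr (hlt i hi hci hne)
    have h0 := (dvd_add_left hrest).1 hdvd
    rw [padicValInt_dvd_iff, hterm a ha i₀ hi₀.2, haj'] at h0
    rcases h0 with h0 | h0
    · exact mul_ne_zero hi₀.2 (pow_ne_zero _ ha) h0
    · omega
  · intro a ha haj
    have haj' : j + 1 ≤ padicValInt p a := by omega
    rw [heval]
    refine dvd_sum fun i hi => ?_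
    by_cases hci : c i = 0
    · simp [hci]
    rw [padicValInt_dvd_iff, hterm a ha i hci]
    right
    have h1 : M ≤ padicValInt p (c i) + (i + 1) * j := hmin i (mem_filter.2 ⟨hi, hci⟩)
    have h2 : (i + 1) * (j + 1) ≤ (i + 1) * padicValInt p a := Nat.mul_le_mul_left _ haj'
    nlinarith

lemma sqNorm_expSum_singleton {s : ℕ} (hs : s ≠ 0) (a : ℤ) (w : ℤ → ℝ) (n : ℤ → ℤ) :
    sqNorm s (expSum {a} w n) = w a ^ 2 := by
  have h : ∀ α, ‖expSum {a} w n α‖ ^ (2 * s) = (w a ^ 2) ^ s := by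
    intro α
    simp only [expSum, sum_singleton, norm_mul, norm_addChar, mul_one, Complex.norm_real]
    rw [pow_mul, Real.norm_eq_abs, sq_abs]
  unfold sqNorm
  simp only [h]
  simp only [integral_const, measureReal_restrict_apply MeasurableSet.univ, Set.univ_inter,
    Real.volume_real_Ico]
  norm_num
  exact Real.pow_rpow_inv_natCast (sq_nonneg _) hs

lemma sqNorm_add_le {s : ℕ} (hs : s ≠ 0) {f g : ℝ → ℂ} (hf : Continuous f) (hg : Continuous g) :
    sqNorm s (fun α => f α + g α) ≤ 2 * (sqNorm s f + sqNorm s g) := by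
  have h := sqNorm_sum_le hs (univ : Finset (Fin 2)) (f := ![f, g]) (by
    intro i _
    fin_cases i
    · exact hf
    · exact hg)
  simpa [Fin.sum_univ_two] using h

lemma sqNorm_natCast_mul {s : ℕ} (hs : s ≠ 0) (m : ℕ) (f : ℝ → ℂ) :
    sqNorm s (fun α => (m : ℂ) * f α) = (m : ℝ) ^ 2 * sqNorm s f := by
  unfold sqNorm
  have h : ∀ α, ‖(m : ℂ) * f α‖ ^ (2 * s) = ((m : ℝ) ^ 2) ^ s * ‖f α‖ ^ (2 * s) := by
    intro α
    rw [norm_mul, mul_pow, Complex.norm_natCast, pow_mul]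
  simp only [h]
  rw [integral_const_mul, Real.mul_rpow (by positivity) (integral_nonneg fun _ => by positivity),
    Real.pow_rpow_inv_natCast (by positivity) hs]

/-- All unexceptional levels form one piece, handled by orthogonality; each exceptional level is a
piece of its own. Cauchy–Schwarz over these at most d² + 1 pieces gives the factor in d. -/
lemma sqNorm_expSum_split_le {k d : ℕ} {φ : Polynomial ℤ} (hd : 1 ≤ d) (hφ : φ.natDegree = d)
    (p : ℕ) [Fact p.Prime] {B : Finset ℤ} (hB : 0 ∉ B) (w : ℤ → ℝ) {v : ℤ → ℤ}
    (hv : ∀ a, v a = padicValInt p a) :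
    sqNorm (k + 1) (expSum B w fun a => φ.eval a) ≤ ((d : ℝ) ^ 2 + 2) * (2 * (k + 1)) ^ 2 *
      ∑ j ∈ B.image v, sqNorm (k + 1) (expSum {a ∈ B | v a = j} w fun a => φ.eval a) := by
  obtain ⟨E, hEcard, hE⟩ := exists_exceptional_valuations hd hφ p
  set n : ℤ → ℤ := fun a => φ.eval a with hn
  set J := B.image v with hJ
  set N : ℤ → ℝ := fun j => sqNorm (k + 1) (expSum {a ∈ B | v a = j} w n) with hN
  have hN0 : ∀ j, 0 ≤ N j := fun j => sqNorm_nonneg _ _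
  have hne : ∀ a ∈ B, a ≠ 0 := fun a ha h => hB (h ▸ ha)
  have hgood : sqNorm (k + 1) (expSum {a ∈ B | v a ∈ J \ E} w n) ≤
      2 * ((k + 1) * (2 * k + 1)) * ∑ j ∈ J \ E, N j := by
    have h := sqNorm_expSum_levels_le (k := k) (B := B) (n := fun a => n a - φ.coeff 0) (v := v) w
      (J \ E) ?_
    · simpa only [sqNorm_expSum_sub_const] using h
    · intro j hj
      obtain ⟨hjJ, hjE⟩ := mem_sdiff.1 hj
      obtain ⟨a, _, rfl⟩ := mem_image.1 hjJ
      obtain ⟨q, hq, h1, h2⟩ := hE (v a) hjE (by rw [hv]; positivity)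
      refine ⟨q, hq, fun b hb hbj => h1 b (hne b hb) ?_, fun b hb hbj => h2 b (hne b hb) ?_⟩
      · rw [← hv]; exact hbj
      · rw [← hv b]; exact hbj
  set F : Option ℤ → ℝ → ℂ := fun o => o.elim (expSum {a ∈ B | v a ∈ J \ E} w n)
    fun j => expSum {a ∈ B | v a = j} w n with hF
  have hdecomp : expSum B w n = fun α => ∑ o ∈ insertNone (J ∩ E), F o α := by
    ext α
    rw [sum_insertNone]
    simp only [hF, Option.elim]
    have h1 : ∑ j ∈ J ∩ E, expSum {a ∈ B | v a = j} w n α =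
        ∑ a ∈ B with v a ∉ J \ E, (w a : ℂ) * addChar (α * (n a : ℝ)) := by
      refine Eq.trans ?_ (sum_fiberwise_of_maps_to (s := {a ∈ B | v a ∉ J \ E}) (t := J ∩ E)
        (g := v) ?_ _)
      · refine sum_congr rfl fun j hj => ?_
        rw [expSum, filter_filter]
        refine sum_congr ?_ fun _ _ => rfl
        ext a
        simp only [mem_filter, mem_sdiff, mem_inter] at hj ⊢
        constructor
        · rintro ⟨ha, rfl⟩
          exact ⟨ha, fun h => h.2 hj.2, rfl⟩
        · rintro ⟨ha, _, rfl⟩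
          exact ⟨ha, rfl⟩
      · intro a ha
        simp only [mem_filter, mem_sdiff, not_and, not_not] at ha
        exact mem_inter.2 ⟨mem_image_of_mem v ha.1, ha.2 (mem_image_of_mem v ha.1)⟩
    rw [h1, expSum, expSum, sum_filter_add_sum_filter_not]
  have hsum := sqNorm_sum_le (s := k + 1) (by omega) (insertNone (J ∩ E)) (f := F) (by
    rintro (_ | j) _ <;> exact continuous_expSum _ _ _)
  rw [← hdecomp, sum_insertNone, card_insertNone] at hsum
  have hcard : ((#(J ∩ E) + 1 : ℕ) : ℝ) ≤ (d : ℝ) ^ 2 + 2 := by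
    have := (card_le_card (inter_subset_right (s₁ := J) (s₂ := E))).trans hEcard
    have h2 : ((#(J ∩ E) : ℕ) : ℝ) ≤ (d : ℝ) ^ 2 := by exact_mod_cast this
    push_cast
    linarith
  have hsplit : ∑ j ∈ J \ E, N j + ∑ j ∈ J ∩ E, N j = ∑ j ∈ J, N j := by
    rw [add_comm]; exact sum_inter_add_sum_sdiff J E N
  have hb0 : 0 ≤ ∑ j ∈ J ∩ E, N j := sum_nonneg fun j _ => hN0 j
  have hg0 : 0 ≤ ∑ j ∈ J \ E, N j := sum_nonneg fun j _ => hN0 j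
  have hC : (2 * ((k + 1) * (2 * k + 1)) : ℝ) ≤ (2 * (k + 1)) ^ 2 := by nlinarith
  have hC1 : (1 : ℝ) ≤ (2 * (k + 1)) ^ 2 := by nlinarith [(Nat.cast_nonneg k : (0 : ℝ) ≤ k)]
  refine hsum.trans ?_
  rw [mul_assoc, ← hsplit]
  refine mul_le_mul hcard ?_ (add_nonneg (sqNorm_nonneg _ _) (sum_nonneg fun j _ => hN0 j))
    (by positivity)
  rw [mul_add]
  refine add_le_add (hgood.trans (mul_le_mul_of_nonneg_right hC hg0)) ?_
  exact le_mul_of_one_le_left hb0 hC1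

/-- The `p`-adic valuations on the integers. -/
noncomputable def intValuation (p : Nat.Primes) (a : ℤ) : ℤ := padicValInt p a

lemma natAbs_eq_of_intValuation_eq {a b : ℤ} (ha : a ≠ 0) (hb : b ≠ 0)
    (h : ∀ p, intValuation p a = intValuation p b) : a.natAbs = b.natAbs := by
  refine Nat.eq_of_factorization_eq (Int.natAbs_ne_zero.2 ha) (Int.natAbs_ne_zero.2 hb) fun p => ?_
  by_cases hp : p.Prime
  · have := h ⟨p, hp⟩
    simp only [intValuation, padicValInt] at this
    rw [Nat.factorization_def _ hp, Nat.factorization_def _ hp]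
    exact_mod_cast this
  · rw [Nat.factorization_eq_zero_of_not_prime _ hp, Nat.factorization_eq_zero_of_not_prime _ hp]

/-- Exponential sums over adaptively split sets satisfy a square function bound. -/
lemma sqNorm_expSum_le_of_adaptiveSplit {k d : ℕ} {φ : Polynomial ℤ} (hd : 1 ≤ d)
    (hφ : φ.natDegree = d) (w : ℤ → ℝ) {m : ℕ} {B : Finset ℤ} (hB : 0 ∉ B)
    (h : AdaptiveSplit intValuation m B) :
    sqNorm (k + 1) (expSum B w fun a => φ.eval a) ≤
      2 * (((d : ℝ) ^ 2 + 2) * (2 * (k + 1)) ^ 2) ^ m * ∑ a ∈ B, w a ^ 2 := by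
  set C : ℝ := ((d : ℝ) ^ 2 + 2) * (2 * (k + 1)) ^ 2 with hC
  have hC1 : 1 ≤ C := by
    have h1 : (1 : ℝ) ≤ (2 * (k + 1)) ^ 2 := by nlinarith [(Nat.cast_nonneg k : (0 : ℝ) ≤ k)]
    exact one_le_mul_of_one_le_of_one_le (by nlinarith [sq_nonneg (d : ℝ)]) h1
  have hne : ∀ a ∈ B, a ≠ 0 := fun a ha h => hB (h ▸ ha)
  induction m generalizing B with
  | zero =>
    rcases B.eq_empty_or_nonempty with rfl | ⟨b, hb⟩
    · simp [sqNorm_expSum_empty]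
    -- Equal valuations at all primes determine an integer up to sign; this is the source of the
    -- factor 2.
    have hcard : #B ≤ 2 := by
      refine (card_le_card (t := {b, -b}) fun a ha => ?_).trans card_le_two
      have := Int.natAbs_eq_natAbs_iff.1
        (natAbs_eq_of_intValuation_eq (hne a ha) (hne b hb) (h a ha b hb))
      simpa using this
    have hsum := sqNorm_sum_le (s := k + 1) (by omega) B
      (f := fun a => expSum {a} w fun a => φ.eval a) fun a _ => continuous_expSum _ _ _
    have hfun : (fun α => ∑ a ∈ B, expSum {a} w (fun a => φ.eval a) α) =
        expSum B w fun a => φ.eval a := by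
      ext α; simp [expSum]
    simp only [hfun, sqNorm_expSum_singleton (Nat.succ_ne_zero k)] at hsum
    rw [pow_zero, mul_one]
    refine hsum.trans (mul_le_mul_of_nonneg_right ?_ (sum_nonneg fun _ _ => sq_nonneg _))
    exact_mod_cast hcard
  | succ m ih =>
    have hW : 0 ≤ ∑ a ∈ B, w a ^ 2 := sum_nonneg fun _ _ => sq_nonneg _
    rcases h with h | ⟨p, h⟩
    · refine (ih hB h hne).trans ?_
      gcongr
      exact Nat.le_succ m
    · have : Fact (p : ℕ).Prime := ⟨p.2⟩
      refine (sqNorm_expSum_split_le hd hφ p hB w (v := intValuation p) fun _ => rfl).trans ?_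
      rw [← hC]
      have h1 : ∑ j ∈ B.image (intValuation p),
          sqNorm (k + 1) (expSum {a ∈ B | intValuation p a = j} w fun a => φ.eval a) ≤
          ∑ j ∈ B.image (intValuation p),
            2 * C ^ m * ∑ a ∈ B with intValuation p a = j, w a ^ 2 :=
        sum_le_sum fun j _ => ih (fun h0 => hB (mem_filter.1 h0).1) (h j)
          fun a ha => hne a (mem_filter.1 ha).1
      rw [← mul_sum, sum_fiberwise_of_maps_to fun a ha => mem_image_of_mem _ ha] at h1
      calc _ ≤ C * (2 * C ^ m * ∑ a ∈ B, w a ^ 2) := by gcongr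
        _ = _ := by ring

/-! ### From small doubling to the norm bound, by averaging over dilates. -/

/-- A set with small doubling in a commutative group contains a dense subset which is adaptively
split at small depth. -/
lemma exists_adaptiveSplit_of_doubling {G ι : Type*} [CommGroup G] [DecidableEq G] {v : ι → G → ℤ}
    (hv : ∀ i x y, v i (x * y) = v i x + v i y) {A : Finset G} (hA : A.Nonempty) {K : ℝ}
    (hK : (#(A * A) : ℝ) ≤ K * #A) :
    ∃ (m : ℕ) (A' : Finset G), A'.Nonempty ∧ AdaptiveSplit v m A' ∧ (2 : ℝ) ^ m ≤ K ^ 3 ∧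
      (#(A / A') : ℝ) ≤ K ^ 5 * #A' := by
  obtain ⟨g, m, A', hg, hexp, hsub, hsplit, hm, hcard⟩ := exists_adaptiveSplit_subset hv A hA
  have hA0 : (0 : ℝ) < #A := by exact_mod_cast hA.card_pos
  have hσ : (#(A * A) : ℝ) / #A ≤ K := (div_le_iff₀ hA0).2 hK
  have hK0 : 0 ≤ K := le_trans (by positivity) hσ
  have hcube : (#(A * A * A) : ℝ) ≤ K ^ 3 * #A := by
    have h := pluennecke_ruzsa_inequality_pow_mul hA A 3
    rw [pow_succ, sq] at h
    have h' : (#(A * A * A) : ℝ) ≤ ((#(A * A) : ℝ) / #A) ^ 3 * #A := by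
      have := (NNRat.cast_le (K := ℝ)).2 h
      push_cast at this
      exact this
    exact h'.trans (by gcongr)
  have hdiv : (#(A / A) : ℝ) ≤ K ^ 2 * #A := by
    have h := pluennecke_ruzsa_inequality_pow_div_pow_mul hA A 1 1
    rw [pow_one] at h
    have h' : (#(A / A) : ℝ) ≤ ((#(A * A) : ℝ) / #A) ^ (1 + 1) * #A := by
      have := (NNRat.cast_le (K := ℝ)).2 h
      push_cast at this
      exact this
    exact h'.trans (by gcongr)
  have hgK : (g : ℝ) ≤ K ^ 3 := by
    have h1 : ((#A * g : ℕ) : ℝ) ^ 2 ≤ (#(A * A * A) : ℝ) ^ 2 := by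
      have := hexp A A
      have h2 : (#A * g) ^ 2 ≤ #(A * A * A) ^ 2 := by rw [mul_pow, sq (#A)]; exact this
      exact_mod_cast h2
    have h2 := (pow_le_pow_iff_left₀ (by positivity) (by positivity) two_ne_zero).1 h1
    push_cast at h2
    refine le_of_mul_le_mul_left ?_ hA0
    linarith
  have hA'0 : 0 < #A' := by
    rcases Nat.eq_zero_or_pos #A' with h | h
    · rw [h, zero_mul] at hcard
      have := hA.card_pos
      omega
    · exact h
  refine ⟨m, A', card_pos.1 hA'0, hsplit, le_trans (by exact_mod_cast hm) hgK, ?_⟩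
  have hcard' : (#A : ℝ) ≤ #A' * g := by exact_mod_cast hcard
  calc (#(A / A') : ℝ) ≤ #(A / A) := by exact_mod_cast card_le_card (div_subset_div_left hsub)
    _ ≤ K ^ 2 * #A := hdiv
    _ ≤ K ^ 2 * (#A' * K ^ 3) := by
      gcongr
      exact hcard'.trans (by gcongr)
    _ = _ := by ring

/-- Nonzero integers as units of `ℚ`. -/
noncomputable def intToUnit (a : ℤ) : ℚˣ := if h : (a : ℚ) = 0 then 1 else Units.mk0 (a : ℚ) h

lemma coe_intToUnit {a : ℤ} (ha : a ≠ 0) : ((intToUnit a : ℚˣ) : ℚ) = a := by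
  have : (a : ℚ) ≠ 0 := by exact_mod_cast ha
  simp [intToUnit, this]

/-- The `p`-adic valuations on the units of `ℚ`. -/
noncomputable def ratValuation (p : Nat.Primes) (x : ℚˣ) : ℤ := padicValRat p (x : ℚ)

lemma ratValuation_mul (p : Nat.Primes) (x y : ℚˣ) :
    ratValuation p (x * y) = ratValuation p x + ratValuation p y := by
  have : Fact (p : ℕ).Prime := ⟨p.2⟩
  rw [ratValuation, Units.val_mul, padicValRat.mul x.ne_zero y.ne_zero]
  rfl

lemma intValuation_eq (p : Nat.Primes) {a : ℤ} (ha : a ≠ 0) :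
    intValuation p a = ratValuation p (intToUnit a) := by
  rw [ratValuation, coe_intToUnit ha, padicValRat.of_int, intValuation]

/-- Each a is counted once for every x = e(a)/y with y ∈ A', hence exactly |A'| times. -/
lemma sum_translates {M : Type*} [AddCommMonoid M] {G : Type*} [CommGroup G] [DecidableEq G]
    (A : Finset ℤ) (e : ℤ → G) (A' : Finset G) (g : ℤ → M) :
    ∑ x ∈ A.image e / A', ∑ a ∈ A with e a / x ∈ A', g a = #A' • ∑ a ∈ A, g a := by
  simp_rw [sum_filter]
  rw [sum_comm, smul_sum]
  refine sum_congr rfl fun a ha => ?_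
  rw [← sum_filter, sum_const]
  congr 1
  have : ({x ∈ A.image e / A' | e a / x ∈ A'} : Finset G) = A'.image fun y => e a / y := by
    ext x
    simp only [mem_filter, mem_image]
    constructor
    · rintro ⟨_, hx⟩
      exact ⟨_, hx, div_div_cancel _ _⟩
    · rintro ⟨y, hy, rfl⟩
      exact ⟨div_mem_div (mem_image_of_mem _ ha) hy, by rwa [div_div_cancel]⟩
  rw [this, card_image_of_injective _ fun x y h => div_right_injective h]

/-- The square-norm bound for sets of nonzero integers with small multiplicative doubling. -/
lemma sqNorm_expSum_le_of_doubling {k d : ℕ} {φ : Polynomial ℤ} (hd : 1 ≤ d)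
    (hφ : φ.natDegree = d) (w : ℤ → ℝ) {A : Finset ℤ} (hA : A.Nonempty) (h0 : 0 ∉ A) {K : ℝ}
    (hK1 : 1 ≤ K) (hK : (#(A * A) : ℝ) ≤ K * #A) :
    ∃ m : ℕ, (2 : ℝ) ^ m ≤ K ^ 3 ∧ sqNorm (k + 1) (expSum A w fun a => φ.eval a) ≤
      K ^ 5 * (2 * (((d : ℝ) ^ 2 + 2) * (2 * (k + 1)) ^ 2) ^ m) * ∑ a ∈ A, w a ^ 2 := by
  have hne : ∀ a ∈ A, a ≠ 0 := fun a ha h => h0 (h ▸ ha)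
  have hinj : Set.InjOn intToUnit A := by
    intro a ha b hb h
    have := congrArg (fun x : ℚˣ => (x : ℚ)) h
    simp only [coe_intToUnit (hne a ha), coe_intToUnit (hne b hb)] at this
    exact_mod_cast this
  have hmul : A.image intToUnit * A.image intToUnit ⊆ (A * A).image intToUnit := by
    intro x hx
    obtain ⟨y, hy, z, hz, rfl⟩ := mem_mul.1 hx
    obtain ⟨a, ha, rfl⟩ := mem_image.1 hy
    obtain ⟨b, hb, rfl⟩ := mem_image.1 hz
    refine mem_image.2 ⟨a * b, mul_mem_mul ha hb, Units.ext ?_⟩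
    rw [coe_intToUnit (mul_ne_zero (hne a ha) (hne b hb)), Units.val_mul,
      coe_intToUnit (hne a ha), coe_intToUnit (hne b hb)]
    push_cast
    rfl
  have hcardA : #(A.image intToUnit) = #A := card_image_of_injOn hinj
  have hdoub : (#(A.image intToUnit * A.image intToUnit) : ℝ) ≤ K * #(A.image intToUnit) := by
    rw [hcardA]
    refine le_trans ?_ hK
    exact_mod_cast (card_le_card hmul).trans card_image_le
  obtain ⟨m, A', hA', hsplit, hm, hdiv⟩ :=
    exists_adaptiveSplit_of_doubling ratValuation_mul (hA.image _) hdoub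
  refine ⟨m, hm, ?_⟩
  set L : ℝ := 2 * (((d : ℝ) ^ 2 + 2) * (2 * (k + 1)) ^ 2) ^ m with hL
  set n : ℤ → ℤ := fun a => φ.eval a with hn
  set X := A.image intToUnit / A' with hX
  set B : ℚˣ → Finset ℤ := fun x => {a ∈ A | intToUnit a / x ∈ A'} with hB
  have hpiece : ∀ x ∈ X, sqNorm (k + 1) (expSum (B x) w n) ≤ L * ∑ a ∈ B x, w a ^ 2 := by
    intro x _
    refine sqNorm_expSum_le_of_adaptiveSplit hd hφ w (fun h => h0 (mem_filter.1 h).1) ?_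
    refine hsplit.comap (fun a => intToUnit a / x) (fun p => ratValuation p x)
      (fun a ha => (mem_filter.1 ha).2) fun a ha p => ?_
    rw [← ratValuation_mul, div_mul_cancel, intValuation_eq p (hne a (mem_filter.1 ha).1)]
  have hsum := sqNorm_sum_le (s := k + 1) (by omega) X (f := fun x => expSum (B x) w n)
    fun x _ => continuous_expSum _ _ _
  have hfun : (fun α => ∑ x ∈ X, expSum (B x) w n α) = fun α => (#A' : ℂ) * expSum A w n α := by
    ext α
    simp only [expSum, hB, hX]
    rw [sum_translates, nsmul_eq_mul]
  rw [hfun, sqNorm_natCast_mul (by omega)] at hsum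
  have hW : ∑ x ∈ X, ∑ a ∈ B x, w a ^ 2 = #A' * ∑ a ∈ A, w a ^ 2 := by
    rw [← nsmul_eq_mul]; exact sum_translates _ _ _ _
  have hA'0 : (0 : ℝ) < #A' := by exact_mod_cast hA'.card_pos
  have hW0 : 0 ≤ ∑ a ∈ A, w a ^ 2 := sum_nonneg fun _ _ => sq_nonneg _
  -- The pieces sum to |A'| times the full sum, so the left side carries |A'|². On the right, |X| ≤
  -- K⁵|A'| and the total weight contributes another |A'|.
  refine le_of_mul_le_mul_left (hsum.trans ?_) (by positivity : (0 : ℝ) < (#A' : ℝ) ^ 2)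
  calc (#X : ℝ) * ∑ x ∈ X, sqNorm (k + 1) (expSum (B x) w n)
      ≤ (K ^ 5 * #A') * ∑ x ∈ X, L * ∑ a ∈ B x, w a ^ 2 := by
        gcongr with x hx
        · exact sum_nonneg fun _ _ => sqNorm_nonneg _ _
        · exact hpiece x hx
    _ = _ := by rw [← mul_sum, hW]; ring

/-! ### Treatment of 0 and bookkeeping of constants. -/

/-- Removing `0` from a set of integers worsens its multiplicative doubling in a controlled way. -/
lemma card_mul_erase_zero_le {A : Finset ℤ} {K : ℝ} (hK1 : 1 ≤ K) (hA : 2 ≤ #A)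
    (hK : (#(A * A) : ℝ) = K * #A) :
    (#(A.erase 0 * A.erase 0) : ℝ) ≤ min (2 * K) (K ^ 2) * #(A.erase 0) := by
  have hA' : (2 : ℝ) ≤ #A := by exact_mod_cast hA
  have hmin : K ≤ min (2 * K) (K ^ 2) := le_min (by linarith) (by nlinarith)
  by_cases h0 : (0 : ℤ) ∈ A
  · have hsub : A.erase 0 * A.erase 0 ⊆ (A * A).erase 0 := by
      intro x hx
      obtain ⟨a, ha, b, hb, rfl⟩ := mem_mul.1 hx
      rw [mem_erase] at ha hb ⊢
      exact ⟨mul_ne_zero ha.1 hb.1, mul_mem_mul ha.2 hb.2⟩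
    have h00 : (0 : ℤ) ∈ A * A := mem_mul.2 ⟨0, h0, 0, h0, by simp⟩
    have h1 := card_le_card hsub
    have h2 := card_erase_add_one h00
    have h3 : (#(A.erase 0 * A.erase 0) : ℝ) + 1 ≤ K * #A := by
      rw [← hK]; exact_mod_cast (by omega)
    have h4 : (#(A.erase 0) : ℝ) + 1 = #A := by exact_mod_cast card_erase_add_one h0
    have h5 : (1 : ℝ) ≤ #(A.erase 0) := by linarith
    rw [← h4] at h3
    -- With n = |A \ {0}| ≥ 1, the bound K(n + 1) - 1 is at most 2Kn, and at most K²n because (K -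
    -- 1)(Kn - 1) ≥ 0.
    rcases min_choice (2 * K) (K ^ 2) with h | h <;> rw [h]
    · nlinarith
    · nlinarith [mul_nonneg (sq_nonneg (K - 1)) (by linarith : (0 : ℝ) ≤ #(A.erase 0)),
        mul_nonneg (by linarith : (0 : ℝ) ≤ K - 1) (by linarith : (0 : ℝ) ≤ #(A.erase 0) - 1)]
  · rw [erase_eq_of_notMem h0, hK]
    gcongr

/-- The bound K' ≤ K² is used for the power depending on d, so that no constant depending on d
appears. The bound K' ≤ 2K is used for the rest, where the power of 2 depends only on s. -/
lemma doubling_constant_le {s d m : ℕ} (hs : 1 ≤ s) {K K' : ℝ} (hK1 : 1 ≤ K)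
    (hK'1 : 1 ≤ K') (hK' : K' ≤ min (2 * K) (K ^ 2)) (hm : (2 : ℝ) ^ m ≤ K' ^ 3) :
    K' ^ 5 * (2 * (((d : ℝ) ^ 2 + 2) * (2 * s) ^ 2) ^ m) ≤
      2 * 2 ^ (5 + 6 * Real.logb 2 (2 * s)) *
        K ^ (8 + 12 * Real.logb 2 ((d : ℝ) ^ 2 + 2) + 6 * Real.logb 2 (2 * s)) := by
  have hs' : (1 : ℝ) ≤ s := by exact_mod_cast hs
  set L := Real.logb 2 ((d : ℝ) ^ 2 + 2) with hL
  set S := Real.logb 2 (2 * (s : ℝ)) with hS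
  have hd0 : (0 : ℝ) < (d : ℝ) ^ 2 + 2 := by positivity
  have hL0 : 0 ≤ L := Real.logb_nonneg (by norm_num) (by nlinarith [sq_nonneg (d : ℝ)])
  have hS0 : 0 ≤ S := Real.logb_nonneg (by norm_num) (by linarith)
  have hK0 : 0 < K := by linarith
  have hK'0 : 0 < K' := by linarith
  have hC : ((d : ℝ) ^ 2 + 2) * (2 * s) ^ 2 = (2 : ℝ) ^ (L + 2 * S) := by
    rw [Real.rpow_add (by norm_num), hL, Real.rpow_logb (by norm_num) (by norm_num) hd0, mul_comm 2 S,
      Real.rpow_mul (by norm_num), hS, Real.rpow_logb (by norm_num) (by norm_num) (by linarith)]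
    norm_cast
  have h1 : (((d : ℝ) ^ 2 + 2) * (2 * s) ^ 2) ^ m ≤ K' ^ (3 * L) * K' ^ (6 * S) := by
    rw [hC, ← Real.rpow_natCast, ← Real.rpow_mul (by norm_num), mul_comm, Real.rpow_mul (by norm_num),
      Real.rpow_natCast, ← Real.rpow_add hK'0]
    calc ((2 : ℝ) ^ m) ^ (L + 2 * S) ≤ (K' ^ 3) ^ (L + 2 * S) := by gcongr
      _ = _ := by
        rw [← Real.rpow_natCast, ← Real.rpow_mul hK'0.le]
        congr 1
        push_cast
        ring
  have h2 : K' ^ (3 * L) ≤ K ^ (6 * L) := by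
    calc K' ^ (3 * L) ≤ (K ^ 2) ^ (3 * L) := by
          gcongr
          exact hK'.trans (min_le_right _ _)
      _ = _ := by
        rw [← Real.rpow_natCast, ← Real.rpow_mul hK0.le]
        congr 1
        push_cast
        ring
  have h3 : K' ^ 5 * K' ^ (6 * S) ≤ 2 ^ (5 + 6 * S) * K ^ (5 + 6 * S) := by
    rw [← Real.rpow_natCast, ← Real.rpow_add hK'0, ← Real.mul_rpow (by norm_num) hK0.le]
    push_cast
    gcongr
    exact hK'.trans (min_le_left _ _)
  calc K' ^ 5 * (2 * (((d : ℝ) ^ 2 + 2) * (2 * s) ^ 2) ^ m)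
      ≤ K' ^ 5 * (2 * (K' ^ (3 * L) * K' ^ (6 * S))) := by gcongr
    _ = 2 * (K' ^ 5 * K' ^ (6 * S)) * K' ^ (3 * L) := by ring
    _ ≤ 2 * (2 ^ (5 + 6 * S) * K ^ (5 + 6 * S)) * K ^ (6 * L) := by gcongr
    _ = 2 * 2 ^ (5 + 6 * S) * K ^ (5 + 6 * S + 6 * L) := by
      rw [Real.rpow_add hK0 (5 + 6 * S)]; ring
    _ ≤ _ := by
      gcongr 2 * 2 ^ (5 + 6 * S) * ?_
      exact Real.rpow_le_rpow_of_exponent_le hK1 (by linarith)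

theorem theorem1p6 (s : ℕ) (hs : 1 ≤ s) :
    ∃ c : ℝ, 0 < c ∧
      ∀ (d : ℕ) (K : ℝ) (A : Finset ℤ) (φ : Polynomial ℤ) (w : ℤ → ℝ),
        1 ≤ d → 1 ≤ K → 2 ≤ A.card →
        ((A * A).card : ℝ) = K * (A.card : ℝ) →
        φ.natDegree = d →
        (∀ n : ℤ, 0 ≤ w n) →
        ∫ α in Set.Ico (0 : ℝ) 1, ‖weightedExpSum A w φ α‖ ^ (2 * s) ≤
          c * K ^ ((8 + 12 * Real.logb 2 ((d : ℝ) ^ 2 + 2) + 6 * Real.logb 2 (2 * (s : ℝ)))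
                * (s : ℝ))
            * (Real.logb 2 (A.card : ℝ)) ^ (2 * s)
            * (∑ a ∈ A, w a ^ 2) ^ s := by
  have hs0 : s ≠ 0 := by omega
  set D : ℝ := 2 * 2 ^ (5 + 6 * Real.logb 2 (2 * (s : ℝ))) with hD
  refine ⟨(2 * D) ^ s, by positivity, fun d K A φ w hd hK1 hA hK hφ _ => ?_⟩
  set E := 8 + 12 * Real.logb 2 ((d : ℝ) ^ 2 + 2) + 6 * Real.logb 2 (2 * (s : ℝ)) with hE
  set n : ℤ → ℤ := fun a => φ.eval a with hn
  have hK0 : 0 < K := by linarith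
  have hs' : (1 : ℝ) ≤ s := by exact_mod_cast hs
  have hS0 : 0 ≤ Real.logb 2 (2 * (s : ℝ)) := Real.logb_nonneg (by norm_num) (by linarith)
  have hL0 : 0 ≤ Real.logb 2 ((d : ℝ) ^ 2 + 2) :=
    Real.logb_nonneg (by norm_num) (by nlinarith [sq_nonneg (d : ℝ)])
  have hD1 : 1 ≤ D := by
    have : (1 : ℝ) ≤ 2 ^ (5 + 6 * Real.logb 2 (2 * (s : ℝ))) :=
      Real.one_le_rpow (by norm_num) (by positivity)
    linarith
  have hKE : 1 ≤ K ^ E := Real.one_le_rpow hK1 (by positivity)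
  have hne : (A.erase 0).Nonempty := by
    rw [← card_pos]
    have := pred_card_le_card_erase (s := A) (a := 0)
    omega
  have hdoub := card_mul_erase_zero_le hK1 hA hK
  have hmin1 : 1 ≤ min (2 * K) (K ^ 2) := le_min (by linarith) (one_le_pow₀ hK1)
  obtain ⟨k, rfl⟩ : ∃ k, s = k + 1 := ⟨s - 1, by omega⟩
  obtain ⟨m, hm, hbound⟩ := sqNorm_expSum_le_of_doubling (k := k) hd hφ w hne (by simp) hmin1 hdoub
  have hconst := doubling_constant_le (d := d) hs hK1 hmin1 le_rfl hm
  push_cast at hconst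
  have hW0 : 0 ≤ ∑ a ∈ A.erase 0, w a ^ 2 := sum_nonneg fun _ _ => sq_nonneg _
  have hnz : sqNorm (k + 1) (expSum (A.erase 0) w n) ≤ D * K ^ E * ∑ a ∈ A.erase 0, w a ^ 2 := by
    refine hbound.trans (mul_le_mul_of_nonneg_right ?_ hW0)
    rw [hD, hE]
    push_cast
    exact hconst
  have hDK : 1 ≤ D * K ^ E := one_le_mul_of_one_le_of_one_le hD1 hKE
  have hall : sqNorm (k + 1) (expSum A w n) ≤ 2 * D * K ^ E * ∑ a ∈ A, w a ^ 2 := by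
    by_cases h0 : (0 : ℤ) ∈ A
    · have hsplit : expSum A w n = fun α => expSum {0} w n α + expSum (A.erase 0) w n α := by
        rw [← expSum_union (by simp), ← insert_eq, insert_erase h0]
      rw [hsplit, ← add_sum_erase A (fun a => w a ^ 2) h0]
      refine (sqNorm_add_le hs0 (continuous_expSum _ _ _) (continuous_expSum _ _ _)).trans ?_
      rw [sqNorm_expSum_singleton hs0]
      have h1 : w 0 ^ 2 ≤ D * K ^ E * w 0 ^ 2 := le_mul_of_one_le_left (sq_nonneg _) hDK
      linarith
    · rw [erase_eq_of_notMem h0] at hnz hW0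
      have : 0 ≤ D * K ^ E * ∑ a ∈ A, w a ^ 2 := by positivity
      linarith
  -- The logarithmic factor is pure slack: it is at least 1 because |A| ≥ 2.
  have hlog : 1 ≤ Real.logb 2 (#A : ℝ) ^ (2 * (k + 1)) := by
    refine one_le_pow₀ ?_
    rw [Real.le_logb_iff_rpow_le (by norm_num) (by positivity), Real.rpow_one]
    exact_mod_cast hA
  have hW : 0 ≤ ∑ a ∈ A, w a ^ 2 := sum_nonneg fun _ _ => sq_nonneg _
  have hint : ∫ α in Set.Ico (0 : ℝ) 1, ‖weightedExpSum A w φ α‖ ^ (2 * (k + 1)) =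
      sqNorm (k + 1) (expSum A w n) ^ (k + 1) := (sqNorm_pow hs0 _).symm
  rw [hint]
  calc sqNorm (k + 1) (expSum A w n) ^ (k + 1)
      ≤ (2 * D * K ^ E * ∑ a ∈ A, w a ^ 2) ^ (k + 1) :=
        pow_le_pow_left₀ (sqNorm_nonneg _ _) hall _
    _ = (2 * D) ^ (k + 1) * K ^ (E * ((k + 1 : ℕ) : ℝ)) * (∑ a ∈ A, w a ^ 2) ^ (k + 1) := by
        rw [mul_pow, mul_pow, Real.rpow_mul hK0.le, Real.rpow_natCast]
    _ ≤ _ := by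
        refine mul_le_mul_of_nonneg_right ?_ (by positivity)
        exact le_mul_of_one_le_right (by positivity) hlog
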